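/- Let $d\ge 1$. For $u>0$ let $h^1(\cdot,u)$ be the characteristic function of $[-u/2,u/2)$ and, for $r\ge 2$, let $h^r(\cdot,u):=h^{r-1}(\cdot,u)*h^1(\cdot,u)$ (convolution on $\mathbb R$). For $\mathbf z\in[0,1)^d$ and $\mathbf u\in(0,1/2]^d$ let $$h^r(\mathbf x,\mathbf z,\mathbf u):=\prod_{j=1}^d h^r(x_j-z_j,u_j),\qquad \tilde h^r(\mathbf x,\mathbf z,\mathbf u):=\sum_{\mathbf k\in\mathbb Z^d}h^r(\mathbf k+\mathbf x,\mathbf z,\mathbf u).$$ For a cubature formula $(\xi,\Lambda)$ with knots $\xi=(\xi^1,\dots,\xi^m)$, $\xi^\mu\in[0,1)^d$, and real weights $\Lambda=(\lambda_1,\dots,\lambda_m)$, and for $1\le p_1,p_2\le\infty$, define $$\tilde D^r_{p_1,p_2}(\xi,\Lambda):=\left\|\,\Big\|\int_{[0,1)^d}\tilde h^r(\mathbf x,\mathbf z,\mathbf u)\,d\mathbf x-\sum_{\mu=1}^m\lambda_\mu\tilde h^r(\xi^\mu,\mathbf z,\mathbf u)\Big\|_{p_1}\right\|_{p_2},$$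 where the $L_{p_1}$ norm is taken with respect to $\mathbf z$ over $[0,1)^d$ and the $L_{p_2}$ norm with respect to $\mathbf u$ over $(0,1/2]^d$. **Proposition.** For all integers $r\ge 1$ and $d\ge 1$ there is a constant $C(r,d)>0$ such that for every integer $m\ge 2$ there exists a cubature formula $(\xi,\Lambda)$ with $m$ knots in $[0,1)^d$ such that $$\tilde D^r_{2,\infty}(\xi,\Lambda)\le C(r,d)\,m^{-r}(\log m)^{(d-1)/2}.$$ -/

import Mathlib

open MeasureTheory Set

open scoped ENNReal

noncomputable section

namespace SmoothDiscrepancy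

/-- The half-open unit cube `[0,1)^d`. -/
def unitCube (d : ℕ) : Set (Fin d → ℝ) :=
  Set.univ.pi fun _ => Set.Ico 0 1

/-- The cube `(0,1/2]^d` of admissible shape parameters `u`. -/
def shapeCube (d : ℕ) : Set (Fin d → ℝ) :=
  Set.univ.pi fun _ => Set.Ioc 0 (1 / 2)

/-- The univariate hat function `h^r(·,u)`: `h^1(·,u)` is the characteristic function of
`[-u/2,u/2)`, and `h^r(·,u) = h^{r-1}(·,u) ∗ h^1(·,u)` (convolution on `ℝ` with respect to
Lebesgue measure) for `r ≥ 2`. Only `r ≥ 1` is meaningful; the value at `r = 0` is a dummy. -/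
def hat (u : ℝ) : ℕ → ℝ → ℝ
  | 0 => 0
  | 1 => (Set.Ico (-u / 2) (u / 2)).indicator 1
  | n + 2 =>
      MeasureTheory.convolution (hat u (n + 1)) ((Set.Ico (-u / 2) (u / 2)).indicator 1)
        (ContinuousLinearMap.mul ℝ ℝ) volume

/-- The multivariate hat function `h^r(x,z,u) = ∏_j h^r(x_j - z_j, u_j)`. -/
def boxHat {d : ℕ} (r : ℕ) (x z u : Fin d → ℝ) : ℝ :=
  ∏ j, hat (u j) r (x j - z j)

/-- The periodization `∑_{k ∈ ℤ^d} f(k + x)` of a compactly supported function `f`. -/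
def periodization {d : ℕ} (f : (Fin d → ℝ) → ℝ) (x : Fin d → ℝ) : ℝ :=
  ∑' k : Fin d → ℤ, f ((fun j => (k j : ℝ)) + x)

/-- The periodic `r`-smooth hat function: the periodization of `h^r(x,z,u)` in the variable `x`. -/
def periodicHat {d : ℕ} (r : ℕ) (x z u : Fin d → ℝ) : ℝ :=
  periodization (fun y => boxHat r y z u) x

/-- The error on the periodic hat function with parameters `z`, `u` of the cubature formula with
knots `ξ` and weights `w`. -/
def cubatureError {d m : ℕ} (r : ℕ) (ξ : Fin m → Fin d → ℝ) (w : Fin m → ℝ)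
    (z u : Fin d → ℝ) : ℝ :=
  (∫ x in unitCube d, periodicHat r x z u) - ∑ μ, w μ * periodicHat r (ξ μ) z u

/-- The periodic `r`-smooth `L_{p₁,p₂}`-discrepancy of the cubature formula with knots `ξ` and
weights `w`: the `L_{p₁}` norm in `z` over `[0,1)^d`, followed by the `L_{p₂}` norm in `u` over
`(0,1/2]^d`, of the cubature error. It takes values in `[0,∞]`. -/
def periodicDiscrepancy {d m : ℕ} (r : ℕ) (p₁ p₂ : ℝ≥0∞)
    (ξ : Fin m → Fin d → ℝ) (w : Fin m → ℝ) : ℝ≥0∞ :=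
  eLpNorm
    (fun u : Fin d → ℝ =>
      eLpNorm (fun z : Fin d → ℝ => cubatureError r ξ w z u) p₁ (volume.restrict (unitCube d)))
    p₂ (volume.restrict (shapeCube d))

end SmoothDiscrepancy

end

/-!
The cubature formulas are Frolov's: the knots run through a shifted and dilated lattice, reduced
modulo one, and the weights are proportional to the values of a B-spline `bspline r` whose integer
translates sum to one.

*Reduction to a worst-case error.* As a function of `z`, the error on the periodic hat functions has
`k`-th Fourier coefficient `∏ⱼ ĥ(-kⱼ)` times the error on the character of frequency `k`
(`charError`). For `uⱼ ≤ 1/2` the factors satisfy `|ĥ(kⱼ)| ≤ (1 + |kⱼ|)^{-r}`, so Parseval's identity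
bounds the `L₂` norm in `z`, uniformly in `u`, by the worst-case error in the periodic Sobolev space
of mixed smoothness `r` (`periodicDiscrepancy_le`).

*Admissible lattice.* The polynomial `∏_{i<d} (X - 4i) - 1` is irreducible and has `d` real roots.
The Vandermonde matrix `W` of the roots sends a nonzero integer vector to the values at the roots of
a nonzero integer polynomial of degree less than `d`. The product of these values is a nonzero
integer, so that `∏ᵢ |(W n)ᵢ| ≥ 1` (`exists_admissible_matrix`).

*Averaging over the shift.* Let the knots be `B⁻¹(s + n)` with `B = t Wᵀ`. For each frequency `k`
the formula is a periodization in `s`, hence by Parseval's identity the mean square of its error over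
`s` is the sum of `|ψ̂(k + t W l)|²` over `l ≠ 0`, where `ψ` is the B-spline. Weighting with
`∏ⱼ (1 + |kⱼ|)^{-2r}` and summing over `k` with Peetre's inequality leaves a constant times
`∑_{l ≠ 0} ∏ⱼ (1 + |t (W l)ⱼ|)^{-2r}` (`exists_lintegral_tsum_shiftedError_le`). Some shift is at
least as good as the average, so no pointwise Poisson summation is needed.

*Counting.* In the last sum all coordinates but the first are localized in dyadic intervals of
lengths about `2^{sⱼ}`. By admissibility the first coordinates of the lattice points in such a slab
have gaps of order at least `t^d / 2^{∑ sⱼ}`, and the slab contributes at most a constant times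
`t^{-2rd} min(1, t^d / 2^{∑ sⱼ})` (`tsum_decay_admissible_le`). Summing over `s ∈ ℕ^{d-1}` gives the
factor `(1 + log t^d)^{d-1}` (`exists_tsum_min_le`). Since `O(t^d)` knots have nonzero weight, the
choice of the largest `t` allowed by `m` knots gives the asserted order.
-/

namespace SmoothDiscrepancy

/-! ### Parseval's identity and unfolding on the unit cube -/

/-- The character `x ↦ exp(-2πi ξ·x)` of `ℝ^d`. -/
noncomputable def chr {d : ℕ} (ξ x : Fin d → ℝ) : ℂ :=
  Complex.exp (-(2 * Real.pi * Complex.I) * (ξ ⬝ᵥ x : ℝ))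

/-- The inclusion of `ℤ^d` in `ℝ^d`. -/
def intVec {d : ℕ} (k : Fin d → ℤ) : Fin d → ℝ := fun j => (k j : ℝ)

section Characters

variable {d : ℕ} (ξ η x y : Fin d → ℝ)

@[simp] lemma norm_chr : ‖chr ξ x‖ = 1 := by
  rw [chr, Complex.norm_exp]
  simp

lemma chr_add_left : chr (ξ + η) x = chr ξ x * chr η x := by
  simp only [chr, add_dotProduct, ← Complex.exp_add, Complex.ofReal_add, mul_add]

lemma chr_add_right : chr ξ (x + y) = chr ξ x * chr ξ y := by
  simp only [chr, dotProduct_add, ← Complex.exp_add, Complex.ofReal_add, mul_add]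

@[simp] lemma chr_zero_left : chr 0 x = 1 := by simp [chr]

lemma chr_neg_left : chr (-ξ) x = chr ξ (-x) := by simp [chr]

@[fun_prop] lemma continuous_chr : Continuous (chr ξ) := by
  unfold chr dotProduct
  fun_prop

lemma chr_eq_prod :
    chr ξ x = ∏ j, Complex.exp (-(2 * Real.pi * Complex.I) * (ξ j * x j : ℝ)) := by
  rw [← Complex.exp_sum, ← Finset.mul_sum, ← Complex.ofReal_sum]
  rfl

lemma chr_intVec_intVec (k n : Fin d → ℤ) : chr (intVec k) (intVec n) = 1 := by
  rw [chr_eq_prod]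
  refine Finset.prod_eq_one fun j _ => ?_
  rw [Complex.exp_eq_one_iff]
  exact ⟨-(k j * n j), by simp only [intVec]; push_cast; ring⟩

lemma chr_intVec_add_intVec (k n : Fin d → ℤ) :
    chr (intVec k) (x + intVec n) = chr (intVec k) x := by
  rw [chr_add_right, chr_intVec_intVec, mul_one]

@[simp] lemma intVec_zero : intVec (0 : Fin d → ℤ) = 0 := by ext; simp [intVec]

end Characters

section Cube

variable {d : ℕ}

lemma measurableSet_unitCube : MeasurableSet (unitCube d) :=
  MeasurableSet.univ_pi fun _ => measurableSet_Ico

@[simp] lemma volume_unitCube : volume (unitCube d) = 1 := by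
  simp [unitCube, volume_pi_pi]

instance : IsProbabilityMeasure (volume.restrict (unitCube d)) := ⟨by simp⟩

-- Mathlib's multivariate Fourier series are stated for the Haar probability measure on the circle.
attribute [local instance] instMeasureSpaceUnitAddCircle

lemma unitCube_ae_eq :
    unitCube d =ᵐ[volume]
      {x : Fin d → ℝ | ∀ i, x i ∈ Ioc ((0 : Fin d → ℝ) i) ((0 : Fin d → ℝ) i + 1)} := by
  have h1 : (univ.pi fun i : Fin d => Ico ((0 : Fin d → ℝ) i) ((1 : Fin d → ℝ) i)) =ᵐ[volume] _ :=
    Measure.univ_pi_Ico_ae_eq_Icc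
  have h2 : (univ.pi fun i : Fin d => Ioc ((0 : Fin d → ℝ) i) ((1 : Fin d → ℝ) i)) =ᵐ[volume] _ :=
    Measure.univ_pi_Ioc_ae_eq_Icc
  have e : {x : Fin d → ℝ | ∀ i, x i ∈ Ioc ((0 : Fin d → ℝ) i) ((0 : Fin d → ℝ) i + 1)} =
      univ.pi fun i : Fin d => Ioc ((0 : Fin d → ℝ) i) ((1 : Fin d → ℝ) i) := by
    ext x
    simp
  rw [e]
  exact h1.trans h2.symm

/-- **Parseval's identity** for square integrable functions on the unit cube. -/
theorem parseval_unitCube (f : (Fin d → ℝ) → ℂ) (hf : MemLp f 2 (volume.restrict (unitCube d))) :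
    ∫⁻ x in unitCube d, ‖f x‖ₑ ^ 2 =
      ∑' k : Fin d → ℤ, ‖∫ x in unitCube d, chr (intVec k) x * f x‖ₑ ^ 2 := by
  set S := {x : Fin d → ℝ | ∀ i, x i ∈ Ioc ((0 : Fin d → ℝ) i) ((0 : Fin d → ℝ) i + 1)} with hS
  have hSm : MeasurableSet S := MeasurableSet.univ_pi' fun _ => measurableSet_Ioc
  have hres : (volume.restrict (unitCube d) : Measure (Fin d → ℝ)) = volume.restrict S :=
    Measure.restrict_congr_set unitCube_ae_eq
  rw [hres] at hf ⊢
  let g : UnitAddTorus (Fin d) → ℂ :=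
    (f ∘ Subtype.val) ∘ UnitAddTorus.measurableEquivPiIoc (0 : Fin d → ℝ)
  have hgf : ∀ x ∈ S, g (fun i => (x i : UnitAddCircle)) = f x := by
    intro x hx
    have := (UnitAddTorus.measurableEquivPiIoc (0 : Fin d → ℝ)).apply_symm_apply ⟨x, hx⟩
    rw [UnitAddTorus.coe_symm_measurableEquivPiIoc_apply] at this
    simp only [g, Function.comp]
    rw [this]
  have hg : MemLp g 2 := by
    refine MemLp.comp_measurePreserving ?_
      (UnitAddTorus.measurePreserving_equivPiIoc (0 : Fin d → ℝ))
    have h1 : MeasurePreserving (Subtype.val : S → (Fin d → ℝ)) (Measure.comap Subtype.val volume)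
        (volume.restrict S) := ⟨measurable_subtype_coe, map_comap_subtype_coe hSm _⟩
    exact hf.comp_measurePreserving h1
  have hae := hg.coeFn_toLp
  have hpars := UnitAddTorus.hasSum_sq_mFourierCoeff (hg.toLp g)
  have hcoef : ∀ k, UnitAddTorus.mFourierCoeff (hg.toLp g) k =
      ∫ x in S, chr (intVec k) x * f x := by
    intro k
    have : UnitAddTorus.mFourierCoeff (hg.toLp g) k = UnitAddTorus.mFourierCoeff g k := by
      refine integral_congr_ae ?_
      filter_upwards [hae] with t ht
      rw [ht]
    rw [this, UnitAddTorus.mFourierCoeff_eq_integral g k 0]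
    refine setIntegral_congr_fun hSm fun x hx => ?_
    simp only [hgf x hx, smul_eq_mul]
    congr 1
    rw [chr_eq_prod]
    simp only [UnitAddTorus.mFourier, ContinuousMap.coe_mk, fourier_coe_apply]
    refine Finset.prod_congr rfl fun j _ => ?_
    congr 1
    simp [intVec]
    ring
  have hint : ∫ t, ‖hg.toLp g t‖ ^ 2 = ∫ x in S, ‖f x‖ ^ 2 := by
    have : ∫ t, ‖hg.toLp g t‖ ^ 2 = ∫ t, ‖g t‖ ^ 2 := by
      refine integral_congr_ae ?_
      filter_upwards [hae] with t ht
      rw [ht]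
    rw [this, UnitAddTorus.integral_preimage (fun t => ‖g t‖ ^ 2) 0]
    refine setIntegral_congr_fun hSm fun x hx => ?_
    simp only [hgf x hx]
  simp only [hcoef, hint] at hpars
  have h3 : ∫⁻ x in S, ‖f x‖ₑ ^ 2 = ENNReal.ofReal (∫ x in S, ‖f x‖ ^ 2) := by
    rw [ofReal_integral_eq_lintegral_ofReal]
    · refine lintegral_congr fun x => ?_
      rw [← ofReal_norm, ENNReal.ofReal_pow (norm_nonneg _)]
    · exact hf.norm.integrable_sq
    · exact Filter.Eventually.of_forall fun x => by positivity
  rw [h3, ← hpars.tsum_eq, ENNReal.ofReal_tsum_of_nonneg (fun _ => by positivity) hpars.summable]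
  refine tsum_congr fun k => ?_
  rw [← ofReal_norm, ENNReal.ofReal_pow (norm_nonneg _)]

/-- Unfolding: if the translates of the unit cube by `N ⊆ ℤ^d` cover the support of `F`, then
summing the translates of `F` over `N` and integrating over the cube gives the integral of `F`. -/
theorem setIntegral_sum_translates (F : (Fin d → ℝ) → ℂ) (hF : Integrable F)
    (N : Finset (Fin d → ℤ)) (hN : ∀ s ∈ unitCube d, ∀ n ∉ N, F (s + intVec n) = 0) :
    ∫ s in unitCube d, ∑ n ∈ N, F (s + intVec n) = ∫ x, F x := by
  have hcube : ∀ n : Fin d → ℤ, ∀ x : Fin d → ℝ,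
      x ∈ (fun y => y - intVec n) ⁻¹' unitCube d ↔ ∀ j, ⌊x j⌋ = n j := by
    intro n x
    simp only [unitCube, mem_preimage, mem_univ_pi, mem_Ico, Pi.sub_apply, intVec, Int.floor_eq_iff]
    refine forall_congr' fun j => ?_
    constructor <;> rintro ⟨h1, h2⟩ <;> constructor <;> linarith
  have hmeas : ∀ n : Fin d → ℤ, MeasurableSet ((fun y => y - intVec n) ⁻¹' unitCube d) := fun n =>
    (measurable_id.sub_const _) measurableSet_unitCube
  rw [integral_finsetSum N fun n _ => (hF.comp_add_right (intVec n)).integrableOn]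
  have h1 : ∀ n ∈ N, ∫ s in unitCube d, F (s + intVec n) =
      ∫ x in (fun y => y - intVec n) ⁻¹' unitCube d, F x := by
    intro n _
    have := (measurePreserving_sub_right (volume : Measure (Fin d → ℝ))
      (intVec n)).setIntegral_preimage_emb (measurableEmbedding_subRight (intVec n))
      (fun s => F (s + intVec n)) (unitCube d)
    rw [← this]
    simp
  rw [Finset.sum_congr rfl h1, ← integral_biUnion_finset N (fun n _ => hmeas n) ?_
    fun n _ => hF.integrableOn]
  · rw [setIntegral_eq_integral_of_forall_compl_eq_zero]
    intro x hx
    have hmem : x ∈ (fun y => y - intVec (fun j => ⌊x j⌋)) ⁻¹' unitCube d := by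
      rw [hcube]; intro j; rfl
    by_cases hn : (fun j => ⌊x j⌋) ∈ N
    · exact absurd (mem_biUnion (show _ ∈ (N : Set (Fin d → ℤ)) from hn) hmem) hx
    · have := hN _ hmem _ hn
      simpa using this
  · intro n _ n' _ hne
    rw [Function.onFun, Set.disjoint_left]
    intro x hx hx'
    rw [hcube] at hx hx'
    exact hne (funext fun j => (hx j).symm.trans (hx' j))

end Cube

/-! ### Fourier transforms of the hat functions -/

section Hat

variable {u : ℝ}

lemma hat_succ (u : ℝ) {r : ℕ} (hr : 1 ≤ r) (x : ℝ) :
    hat u (r + 1) x = ∫ t, hat u r t * (Ico (-u / 2) (u / 2)).indicator 1 (x - t) := by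
  obtain ⟨n, rfl⟩ : ∃ n, r = n + 1 := ⟨r - 1, by omega⟩
  rfl

lemma measurable_hat (u : ℝ) (r : ℕ) : Measurable (hat u r) := by
  rcases Nat.eq_zero_or_pos r with rfl | hr
  · exact measurable_const
  induction r, hr using Nat.le_induction with
  | base => exact measurable_one.indicator measurableSet_Ico
  | succ r hr ih =>
    have h : StronglyMeasurable (Function.uncurry fun x t : ℝ =>
        hat u r t * (Ico (-u / 2) (u / 2)).indicator (1 : ℝ → ℝ) (x - t)) := by
      refine Measurable.stronglyMeasurable ?_
      exact (ih.comp measurable_snd).mul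
        ((measurable_one.indicator measurableSet_Ico).comp (measurable_fst.sub measurable_snd))
    have := (h.integral_prod_right (ν := volume)).measurable
    rwa [show hat u (r + 1) = _ from funext fun x => hat_succ u hr x]

lemma abs_hat_le_one (hu : 0 < u) (hu1 : u ≤ 1) {r : ℕ} (hr : 1 ≤ r) (x : ℝ) :
    |hat u r x| ≤ 1 := by
  induction r, hr using Nat.le_induction generalizing x with
  | base =>
    by_cases h : x ∈ Ico (-u / 2) (u / 2) <;> simp [hat, h]
  | succ r hr ih =>
    rw [hat_succ u hr]
    have hind : ∀ t, (Ico (-u / 2) (u / 2)).indicator (1 : ℝ → ℝ) (x - t) =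
        (Ioc (x - u / 2) (x + u / 2)).indicator 1 t := by
      intro t
      simp only [indicator, mem_Ico, mem_Ioc, Pi.one_apply]
      congr 1
      apply propext
      constructor <;> rintro ⟨h1, h2⟩ <;> constructor <;> linarith
    simp only [hind]
    rw [← Real.norm_eq_abs]
    refine (norm_integral_le_of_norm_le (μ := volume)
      (g := (Ioc (x - u / 2) (x + u / 2)).indicator (1 : ℝ → ℝ))
      ?_ (Filter.Eventually.of_forall fun t => ?_)).trans ?_
    · exact (integrable_indicator_iff measurableSet_Ioc).2
        (integrableOn_const measure_Ioc_lt_top.ne)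
    · rw [norm_mul]
      have h0 : 0 ≤ (Ioc (x - u / 2) (x + u / 2)).indicator (1 : ℝ → ℝ) t :=
        indicator_nonneg (fun _ _ => zero_le_one) _
      rw [Real.norm_of_nonneg h0]
      exact mul_le_of_le_one_left h0 (ih t)
    · rw [integral_indicator_one measurableSet_Ioc]
      simp only [Measure.real, Real.volume_Ioc]
      rw [ENNReal.toReal_ofReal (by linarith)]
      linarith

lemma hat_eq_zero_of_lt_abs {r : ℕ} (hr : 1 ≤ r) {x : ℝ} (hx : r * u / 2 < |x|) :
    hat u r x = 0 := by
  induction r, hr using Nat.le_induction generalizing x with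
  | base =>
    refine indicator_of_notMem (fun h => ?_) _
    have : |x| ≤ u / 2 := abs_le.2 ⟨by linarith [h.1], h.2.le⟩
    push_cast at hx
    linarith
  | succ r hr ih =>
    rw [hat_succ u hr]
    refine integral_eq_zero_of_ae (Filter.Eventually.of_forall fun t => ?_)
    by_cases ht : x - t ∈ Ico (-u / 2) (u / 2)
    · have h1 : |x - t| ≤ u / 2 := abs_le.2 ⟨by linarith [ht.1], ht.2.le⟩
      have h2 : |x| ≤ |x - t| + |t| := by simpa using abs_add_le (x - t) t
      push_cast at hx
      have h3 : hat u r t = 0 := ih (by linarith)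
      simp [h3]
    · simp [indicator_of_notMem ht]

lemma integrable_hat (hu : 0 < u) (hu1 : u ≤ 1) {r : ℕ} (hr : 1 ≤ r) : Integrable (hat u r) := by
  have : Integrable ((Icc (-(r * u / 2)) (r * u / 2)).indicator (1 : ℝ → ℝ)) :=
    (integrable_indicator_iff measurableSet_Icc).2 (integrableOn_const measure_Icc_lt_top.ne)
  refine this.mono' (measurable_hat u r).aestronglyMeasurable
    (Filter.Eventually.of_forall fun x => ?_)
  by_cases hx : r * u / 2 < |x|
  · rw [hat_eq_zero_of_lt_abs hr hx, norm_zero]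
    exact indicator_nonneg (fun _ _ => zero_le_one) _
  · have hmem : x ∈ Icc (-(r * u / 2)) (r * u / 2) := abs_le.1 (not_lt.1 hx)
    rw [indicator_of_mem hmem]
    exact abs_hat_le_one hu hu1 hr x

/-- The Fourier transform of the univariate hat function. -/
noncomputable def hatFT (u : ℝ) (r : ℕ) (ξ : ℝ) : ℂ :=
  ∫ x, Complex.exp (-(2 * Real.pi * Complex.I) * (ξ * x : ℝ)) * (hat u r x : ℂ)

open FourierTransform in
lemma hatFT_eq_fourier (u : ℝ) (r : ℕ) (ξ : ℝ) :
    hatFT u r ξ = 𝓕 (fun x => (hat u r x : ℂ)) ξ := by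
  rw [Real.fourier_real_eq]
  refine integral_congr_ae (Filter.Eventually.of_forall fun x => ?_)
  simp only [Circle.smul_def, smul_eq_mul, Real.fourierChar_apply]
  congr 2
  push_cast
  ring

open FourierTransform in
lemma hatFT_eq_pow (hu : 0 < u) (hu1 : u ≤ 1) {r : ℕ} (hr : 1 ≤ r) (ξ : ℝ) :
    hatFT u r ξ = hatFT u 1 ξ ^ r := by
  induction r, hr using Nat.le_induction with
  | base => simp
  | succ r hr ih =>
    have h1 : Integrable fun x => (hat u r x : ℂ) := (integrable_hat hu hu1 hr).ofReal
    have h2 : Integrable fun x => (hat u 1 x : ℂ) := (integrable_hat hu hu1 le_rfl).ofReal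
    rw [pow_succ, ← ih, hatFT_eq_fourier, hatFT_eq_fourier, hatFT_eq_fourier,
      ← Real.fourier_mul_convolution_eq h1 h2]
    refine congrArg (fun f : ℝ → ℂ => 𝓕 f ξ) (funext fun x => ?_)
    rw [hat_succ u hr, ← integral_complex_ofReal]
    refine integral_congr_ae (Filter.Eventually.of_forall fun t => ?_)
    simp [hat]

lemma hatFT_one_eq (hu : 0 < u) (ξ : ℝ) :
    hatFT u 1 ξ = ∫ x in (-u / 2)..(u / 2), Complex.exp (-(2 * Real.pi * ξ * Complex.I) * x) := by
  rw [intervalIntegral.integral_of_le (by linarith), ← integral_Ico_eq_integral_Ioc,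
    ← integral_indicator measurableSet_Ico]
  refine integral_congr_ae (Filter.Eventually.of_forall fun x => ?_)
  by_cases h : x ∈ Ico (-u / 2) (u / 2)
  · simp only [hat, indicator_of_mem h, Pi.one_apply]
    rw [Complex.ofReal_one, mul_one]
    congr 1
    push_cast
    ring
  · simp [hat, indicator_of_notMem h]

lemma norm_hatFT_one_le (hu : 0 < u) (ξ : ℝ) : ‖hatFT u 1 ξ‖ ≤ u := by
  rw [hatFT_one_eq hu]
  have := intervalIntegral.norm_integral_le_of_norm_le_const (a := -u / 2) (b := u / 2) (C := 1)
    (f := fun x : ℝ => Complex.exp (-(2 * Real.pi * ξ * Complex.I) * x)) (fun x _ => ?_)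
  · refine this.trans ?_
    rw [one_mul, abs_le]
    constructor <;> linarith
  · rw [Complex.norm_exp]
    simp

lemma hatFT_one_eq_div (hu : 0 < u) {ξ : ℝ} (hξ : ξ ≠ 0) :
    hatFT u 1 ξ = (Complex.exp (-(2 * Real.pi * ξ * Complex.I) * (u / 2 : ℝ)) -
      Complex.exp (-(2 * Real.pi * ξ * Complex.I) * (-u / 2 : ℝ))) /
        (-(2 * Real.pi * ξ * Complex.I)) := by
  rw [hatFT_one_eq hu, integral_exp_mul_complex]
  simp [hξ, Real.pi_ne_zero]

lemma norm_hatFT_one_le_div (hu : 0 < u) {ξ : ℝ} (hξ : ξ ≠ 0) :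
    ‖hatFT u 1 ξ‖ ≤ 1 / (Real.pi * |ξ|) := by
  rw [hatFT_one_eq_div hu hξ, norm_div]
  have h1 : ‖-(2 * Real.pi * ξ * Complex.I)‖ = 2 * (Real.pi * |ξ|) := by
    simp [abs_of_pos Real.pi_pos]
    ring
  have h2 : ∀ x : ℝ, ‖Complex.exp (-(2 * Real.pi * ξ * Complex.I) * x)‖ = 1 := by
    intro x
    rw [Complex.norm_exp]
    simp
  have hpos : 0 < Real.pi * |ξ| := mul_pos Real.pi_pos (abs_pos.2 hξ)
  rw [h1, div_le_div_iff₀ (by positivity) hpos]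
  have := norm_sub_le (Complex.exp (-(2 * Real.pi * ξ * Complex.I) * (u / 2 : ℝ)))
    (Complex.exp (-(2 * Real.pi * ξ * Complex.I) * (-u / 2 : ℝ)))
  rw [h2, h2] at this
  nlinarith

lemma norm_hatFT_one_one_le (ξ : ℝ) : ‖hatFT 1 1 ξ‖ ≤ 2 / (1 + |ξ|) := by
  have h1 := norm_hatFT_one_le one_pos ξ
  rcases le_total (|ξ|) 1 with h | h
  · refine h1.trans ?_
    rw [le_div_iff₀ (by positivity)]
    linarith
  · have hξ : ξ ≠ 0 := by rintro rfl; norm_num at h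
    refine (norm_hatFT_one_le_div one_pos hξ).trans ?_
    have := Real.pi_gt_three
    rw [div_le_div_iff₀ (by positivity) (by positivity)]
    nlinarith

/-- The Fourier coefficients of the hat function are dominated uniformly in the shape parameter. -/
lemma norm_hatFT_one_intCast_le (hu : 0 < u) (hu2 : u ≤ 1 / 2) (k : ℤ) :
    ‖hatFT u 1 k‖ ≤ 1 / (1 + |(k : ℝ)|) := by
  by_cases hk : k = 0
  · subst hk
    refine (norm_hatFT_one_le hu _).trans ?_
    norm_num
    linarith
  · have hk' : (k : ℝ) ≠ 0 := by exact_mod_cast hk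
    have hk1 : (1 : ℝ) ≤ |(k : ℝ)| := by exact_mod_cast Int.one_le_abs hk
    refine (norm_hatFT_one_le_div hu hk').trans ?_
    have := Real.pi_gt_three
    rw [div_le_div_iff₀ (by positivity) (by positivity)]
    nlinarith

lemma hatFT_one_one_intCast (k : ℤ) : hatFT 1 1 k = if k = 0 then 1 else 0 := by
  split_ifs with hk
  · subst hk
    rw [hatFT_one_eq one_pos]
    norm_num
  · have hk' : ((k : ℤ) : ℝ) ≠ 0 := by exact_mod_cast hk
    rw [hatFT_one_eq_div one_pos hk', div_eq_zero_iff]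
    left
    rw [sub_eq_zero, Complex.exp_eq_exp_iff_exists_int]
    refine ⟨-k, ?_⟩
    push_cast
    ring

end Hat

section BoxHat

variable {d : ℕ} {u : Fin d → ℝ}

lemma measurable_boxHat (r : ℕ) (u : Fin d → ℝ) : Measurable fun x => boxHat r x 0 u := by
  unfold boxHat
  exact Finset.measurable_prod _ fun j _ =>
    (measurable_hat (u j) r).comp ((measurable_pi_apply j).sub_const _)

lemma boxHat_eq_sub (r : ℕ) (x z u : Fin d → ℝ) : boxHat r x z u = boxHat r (x - z) 0 u := by
  simp [boxHat]

lemma abs_boxHat_le_one (hu : ∀ j, 0 < u j) (hu1 : ∀ j, u j ≤ 1) {r : ℕ} (hr : 1 ≤ r)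
    (x z : Fin d → ℝ) : |boxHat r x z u| ≤ 1 := by
  rw [boxHat, Finset.abs_prod]
  exact Finset.prod_le_one (fun _ _ => abs_nonneg _) fun j _ => abs_hat_le_one (hu j) (hu1 j) hr _

lemma boxHat_eq_zero (hu1 : ∀ j, u j ≤ 1) {r : ℕ} (hr : 1 ≤ r) {x : Fin d → ℝ}
    {j : Fin d} (hx : (r : ℝ) / 2 < |x j|) : boxHat r x 0 u = 0 := by
  refine Finset.prod_eq_zero (Finset.mem_univ j) (hat_eq_zero_of_lt_abs hr ?_)
  have := hu1 j
  have : (r : ℝ) * u j ≤ r := mul_le_of_le_one_right (Nat.cast_nonneg r) this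
  simp only [Pi.zero_apply, sub_zero]
  linarith

lemma integrable_boxHat (hu : ∀ j, 0 < u j) (hu1 : ∀ j, u j ≤ 1) {r : ℕ} (hr : 1 ≤ r) :
    Integrable fun x => (boxHat r x 0 u : ℂ) := by
  refine Integrable.ofReal ?_
  simp only [Pi.zero_apply, sub_zero]
  exact Integrable.fintype_prod fun j => integrable_hat (hu j) (hu1 j) hr

/-- The Fourier transform of the multivariate hat function factorizes. -/
lemma integral_chr_mul_boxHat (hu : ∀ j, 0 < u j) (hu1 : ∀ j, u j ≤ 1) {r : ℕ} (hr : 1 ≤ r)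
    (ξ : Fin d → ℝ) :
    ∫ x, chr ξ x * (boxHat r x 0 u : ℂ) = ∏ j, hatFT (u j) 1 (ξ j) ^ r := by
  simp only [fun j => (hatFT_eq_pow (hu j) (hu1 j) hr (ξ j)).symm]
  simp only [hatFT]
  rw [← integral_fintype_prod_volume_eq_prod (fun j (x : ℝ) =>
    Complex.exp (-(2 * Real.pi * Complex.I) * (ξ j * x : ℝ)) * (hat (u j) r x : ℂ))]
  refine integral_congr_ae (Filter.Eventually.of_forall fun x => ?_)
  simp only [chr_eq_prod, boxHat, Finset.prod_mul_distrib, Pi.zero_apply, sub_zero,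
    Complex.ofReal_prod]

end BoxHat

/-! ### Discrepancy and worst-case error in mixed Sobolev spaces -/

section

variable {d m : ℕ}

/-- The decay factor `(1 + |y|)^{-2r}` of the mixed Sobolev space of smoothness `r`. -/
noncomputable def decay (r : ℕ) (y : ℝ) : ℝ≥0∞ := ENNReal.ofReal (((1 + |y|) ^ (2 * r))⁻¹)

/-- The error of a cubature formula on the character with frequency `k ∈ ℤ^d`. -/
noncomputable def charError (ξ : Fin m → Fin d → ℝ) (w : Fin m → ℝ) (k : Fin d → ℤ) : ℂ :=
  (if k = 0 then 1 else 0) - ∑ μ, (w μ : ℂ) * chr (intVec k) (ξ μ)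

/-- The square of the worst-case error of a cubature formula in the unit ball of the periodic
Sobolev space of mixed smoothness `r`, in which the coefficient of frequency `k` is weighted with
`∏ⱼ (1 + |kⱼ|)^{2r}`. -/
noncomputable def sqWorstCaseError (r : ℕ) (ξ : Fin m → Fin d → ℝ) (w : Fin m → ℝ) : ℝ≥0∞ :=
  ∑' k : Fin d → ℤ, (∏ j, decay r (k j)) * ‖charError ξ w k‖ₑ ^ 2

/-- The integer points of the cube `[-R,R]^d`. -/
noncomputable def intBox (d R : ℕ) : Finset (Fin d → ℤ) :=
  Fintype.piFinset fun _ => Finset.Icc (-(R : ℤ)) R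

lemma notMem_intBox {R : ℕ} {n : Fin d → ℤ} : n ∉ intBox d R ↔ ∃ j, (R : ℤ) < |n j| := by
  simp only [intBox, Fintype.mem_piFinset, Finset.mem_Icc, not_forall, ← abs_le, not_le]

lemma mem_intBox {R : ℕ} {n : Fin d → ℤ} : n ∈ intBox d R ↔ ∀ j, |n j| ≤ (R : ℤ) := by
  simp only [intBox, Fintype.mem_piFinset, Finset.mem_Icc, ← abs_le]

lemma boxHat_add_intVec_eq_zero {u : Fin d → ℝ} (hu1 : ∀ j, u j ≤ 1) {r : ℕ} (hr : 1 ≤ r)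
    {y : Fin d → ℝ} (hy : ∀ j, |y j| ≤ 1) {n : Fin d → ℤ} (hn : n ∉ intBox d (r + 1)) :
    boxHat r (y + intVec n) 0 u = 0 := by
  obtain ⟨j, hj⟩ := notMem_intBox.1 hn
  refine boxHat_eq_zero hu1 hr (j := j) ?_
  have h1 : ((r : ℝ) + 1) < |(n j : ℝ)| := by exact_mod_cast hj
  have h2 : |(n j : ℝ)| ≤ |y j + n j| + |y j| := by
    simpa using abs_sub (y j + n j) (y j)
  simp only [Pi.add_apply, intVec]
  have := hy j
  have : (0 : ℝ) ≤ r := Nat.cast_nonneg r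
  linarith

lemma abs_sub_le_one_of_mem_unitCube {x z : Fin d → ℝ} (hx : x ∈ unitCube d) (hz : z ∈ unitCube d)
    (j : Fin d) : |(x - z) j| ≤ 1 := by
  have h1 := hx j (mem_univ j)
  have h2 := hz j (mem_univ j)
  rw [Pi.sub_apply, abs_le]
  constructor <;> linarith [h1.1, h1.2, h2.1, h2.2]

lemma periodicHat_eq_sum_add {u : Fin d → ℝ} (hu1 : ∀ j, u j ≤ 1) {r : ℕ} (hr : 1 ≤ r)
    {x z : Fin d → ℝ} (hx : x ∈ unitCube d) (hz : z ∈ unitCube d) :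
    periodicHat r x z u = ∑ n ∈ intBox d (r + 1), boxHat r (x + intVec n - z) 0 u := by
  have h : ∀ n : Fin d → ℤ, boxHat r ((fun j => (n j : ℝ)) + x) z u =
      boxHat r (x + intVec n - z) 0 u := by
    intro n
    rw [boxHat_eq_sub, add_comm x]
    rfl
  simp only [periodicHat, periodization, h]
  refine tsum_eq_sum fun n hn => ?_
  rw [add_sub_right_comm]
  exact boxHat_add_intVec_eq_zero hu1 hr (abs_sub_le_one_of_mem_unitCube hx hz) hn

lemma periodicHat_eq_sum_sub {u : Fin d → ℝ} (hu1 : ∀ j, u j ≤ 1) {r : ℕ} (hr : 1 ≤ r)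
    {x z : Fin d → ℝ} (hx : x ∈ unitCube d) (hz : z ∈ unitCube d) :
    periodicHat r x z u = ∑ n ∈ intBox d (r + 1), boxHat r (x - (z + intVec n)) 0 u := by
  rw [periodicHat_eq_sum_add hu1 hr hx hz]
  refine Finset.sum_equiv (Equiv.neg _) (fun n => by simp [mem_intBox]) fun n _ => ?_
  congr 1
  ext j
  simp [intVec]
  ring

lemma setIntegral_unitCube_periodicHat {u : Fin d → ℝ} (hu : ∀ j, 0 < u j) (hu1 : ∀ j, u j ≤ 1)
    {r : ℕ} (hr : 1 ≤ r) {z : Fin d → ℝ} (hz : z ∈ unitCube d) :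
    ((∫ x in unitCube d, periodicHat r x z u : ℝ) : ℂ) = ∏ j, hatFT (u j) 1 0 ^ r := by
  have h0 := integral_chr_mul_boxHat hu hu1 hr 0
  simp only [chr_zero_left, one_mul, Pi.zero_apply] at h0
  rw [← h0, ← integral_sub_right_eq_self (fun x => (boxHat r x 0 u : ℂ)) z,
    ← integral_complex_ofReal, ← setIntegral_sum_translates _ ((integrable_boxHat hu hu1 hr).comp_sub_right z)
      (intBox d (r + 1))]
  · refine setIntegral_congr_fun measurableSet_unitCube fun x hx => ?_
    simp only [periodicHat_eq_sum_add hu1 hr hx hz, Complex.ofReal_sum]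
  · intro s hs n hn
    rw [add_sub_right_comm, boxHat_add_intVec_eq_zero hu1 hr
      (abs_sub_le_one_of_mem_unitCube hs hz) hn, Complex.ofReal_zero]

lemma setIntegral_unitCube_chr (k : Fin d → ℤ) :
    ∫ z in unitCube d, chr (intVec k) z = if k = 0 then 1 else 0 := by
  have h1 : ∀ l : ℤ, ∫ x in Ico (0 : ℝ) 1,
      Complex.exp (-(2 * Real.pi * Complex.I) * ((l : ℝ) * x : ℝ)) = if l = 0 then 1 else 0 := by
    intro l
    rw [integral_Ico_eq_integral_Ioc, ← intervalIntegral.integral_of_le zero_le_one]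
    split_ifs with hl
    · simp [hl]
    · have hl' : (l : ℂ) ≠ 0 := by exact_mod_cast hl
      have hc : -(2 * Real.pi * Complex.I) * l ≠ 0 := by simp [hl', Real.pi_ne_zero]
      have := integral_exp_mul_complex (a := 0) (b := 1) hc
      simp only [Complex.ofReal_mul, Complex.ofReal_intCast, ← mul_assoc]
      rw [this, div_eq_zero_iff]
      left
      rw [sub_eq_zero, Complex.exp_eq_exp_iff_exists_int]
      refine ⟨-l, ?_⟩
      push_cast
      ring
  have h2 : (volume.restrict (unitCube d) : Measure (Fin d → ℝ)) =
      Measure.pi fun _ => volume.restrict (Ico (0 : ℝ) 1) := by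
    rw [unitCube, volume_pi, Measure.restrict_pi_pi]
  rw [h2]
  simp only [chr_eq_prod]
  rw [integral_fintype_prod_eq_prod (fun j (x : ℝ) =>
    Complex.exp (-(2 * Real.pi * Complex.I) * (intVec k j * x : ℝ)))]
  simp only [intVec, h1]
  rw [Finset.prod_ite_zero]
  simp [funext_iff]

lemma setIntegral_unitCube_chr_mul_sum {u : Fin d → ℝ} (hu : ∀ j, 0 < u j) (hu1 : ∀ j, u j ≤ 1)
    {r : ℕ} (hr : 1 ≤ r) {x : Fin d → ℝ} (hx : x ∈ unitCube d) (k : Fin d → ℤ) :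
    ∫ z in unitCube d, chr (intVec k) z *
      ∑ n ∈ intBox d (r + 1), (boxHat r (x - (z + intVec n)) 0 u : ℂ) =
      chr (intVec k) x * ∏ j, hatFT (u j) 1 (-k j : ℤ) ^ r := by
  have hF : ∀ y : Fin d → ℝ, chr (intVec k) (x - y) * (boxHat r y 0 u : ℂ) =
      chr (intVec k) x * (chr (intVec (-k)) y * (boxHat r y 0 u : ℂ)) := by
    intro y
    rw [show intVec (-k) = -intVec k by ext; simp [intVec], chr_neg_left, ← mul_assoc,
      ← chr_add_right, sub_eq_add_neg]
  have hint : Integrable fun y => chr (intVec k) (x - y) * (boxHat r y 0 u : ℂ) := by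
    refine (integrable_boxHat hu hu1 hr).bdd_mul (c := 1) ?_
      (Filter.Eventually.of_forall fun y => ?_)
    · exact ((continuous_chr _).comp (continuous_const.sub continuous_id)).aestronglyMeasurable
    · simp
  have hint' := hint.comp_sub_left x
  simp only [sub_sub_cancel] at hint'
  have := setIntegral_sum_translates _ hint' (intBox d (r + 1)) ?_
  · simp only [chr_intVec_add_intVec, ← Finset.mul_sum] at this
    rw [this]
    have h2 := integral_sub_left_eq_self
      (fun y => chr (intVec k) (x - y) * (boxHat r y 0 u : ℂ)) volume x
    simp only [sub_sub_cancel] at h2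
    rw [h2]
    simp only [hF]
    rw [integral_const_mul, integral_chr_mul_boxHat hu hu1 hr]
    rfl
  · intro s hs n hn
    rw [show x - (s + intVec n) = x - s + intVec (-n) by ext; simp [intVec]; ring,
      boxHat_add_intVec_eq_zero hu1 hr (abs_sub_le_one_of_mem_unitCube hx hs)
        (by simpa [mem_intBox] using hn), Complex.ofReal_zero, mul_zero]

/-- By Parseval's identity in `z`, the `L_2` norm of the error on the hat functions with shape `u`
is at most the worst-case error in the Sobolev space of mixed smoothness, uniformly in `u`. -/
lemma lintegral_cubatureError_le {r : ℕ} (hr : 1 ≤ r) (ξ : Fin m → Fin d → ℝ)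
    (hξ : ∀ μ, ξ μ ∈ unitCube d) (w : Fin m → ℝ) {u : Fin d → ℝ} (hu : u ∈ shapeCube d) :
    ∫⁻ z in unitCube d, ‖cubatureError r ξ w z u‖ₑ ^ 2 ≤ sqWorstCaseError r ξ w := by
  have hu0 : ∀ j, 0 < u j := fun j => (hu j (mem_univ j)).1
  have hu2 : ∀ j, u j ≤ 1 / 2 := fun j => (hu j (mem_univ j)).2
  have hu1 : ∀ j, u j ≤ 1 := fun j => (hu2 j).trans (by norm_num)
  set I₀ : ℂ := ∏ j, hatFT (u j) 1 0 ^ r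
  let S : (Fin d → ℝ) → (Fin d → ℝ) → ℂ := fun x z =>
    ∑ n ∈ intBox d (r + 1), (boxHat r (x - (z + intVec n)) 0 u : ℂ)
  let E : (Fin d → ℝ) → ℂ := fun z => I₀ - ∑ μ, (w μ : ℂ) * S (ξ μ) z
  have hE : ∀ z ∈ unitCube d, ((cubatureError r ξ w z u : ℝ) : ℂ) = E z := by
    intro z hz
    rw [cubatureError, Complex.ofReal_sub, setIntegral_unitCube_periodicHat hu0 hu1 hr hz]
    simp only [E, S, Complex.ofReal_sum, Complex.ofReal_mul,
      periodicHat_eq_sum_sub hu1 hr (hξ _) hz, I₀]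
  have hmemS : ∀ x, MemLp (S x) 2 (volume.restrict (unitCube d)) := by
    intro x
    refine memLp_finsetSum _ fun n _ => MemLp.of_bound (C := 1) ?_
      (Filter.Eventually.of_forall fun z => ?_)
    · refine (Complex.measurable_ofReal.comp ((measurable_boxHat r u).comp ?_)).aestronglyMeasurable
      exact measurable_const.sub (measurable_id.add_const _)
    · rw [Complex.norm_real]
      exact abs_boxHat_le_one hu0 hu1 hr _ _
  have hmemE : MemLp E 2 (volume.restrict (unitCube d)) :=
    (memLp_const _).sub (memLp_finsetSum _ fun μ _ => (hmemS (ξ μ)).const_mul _)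
  have hcoef : ∀ k : Fin d → ℤ, ∫ z in unitCube d, chr (intVec k) z * E z =
      (∏ j, hatFT (u j) 1 (-k j : ℤ) ^ r) * charError ξ w k := by
    intro k
    have hI : ∀ x, Integrable (fun z => chr (intVec k) z * S x z)
        (volume.restrict (unitCube d)) := by
      intro x
      refine ((hmemS x).integrable one_le_two).bdd_mul (c := 1)
        (continuous_chr _).aestronglyMeasurable (Filter.Eventually.of_forall fun z => by simp)
    have hchr : Integrable (fun z => chr (intVec k) z) (volume.restrict (unitCube d)) :=
      (MemLp.of_bound (C := 1) (p := 1) (continuous_chr _).aestronglyMeasurable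
        (Filter.Eventually.of_forall fun z => by simp)).integrable le_rfl
    have : ∀ z, chr (intVec k) z * E z =
        I₀ * chr (intVec k) z - ∑ μ, (w μ : ℂ) * (chr (intVec k) z * S (ξ μ) z) := by
      intro z
      simp only [E, mul_sub, Finset.mul_sum]
      congr 1
      · ring
      · exact Finset.sum_congr rfl fun μ _ => by ring
    simp only [this]
    rw [integral_sub (hchr.const_mul _) (integrable_finsetSum _ fun μ _ => (hI _).const_mul _),
      integral_const_mul, setIntegral_unitCube_chr,
      integral_finsetSum _ fun μ _ => (hI _).const_mul _]
    simp only [integral_const_mul, S, setIntegral_unitCube_chr_mul_sum hu0 hu1 hr (hξ _)]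
    rw [charError, mul_sub, Finset.mul_sum]
    congr 1
    · split_ifs with hk
      · simp [hk, I₀]
      · simp
    · exact Finset.sum_congr rfl fun μ _ => by ring
  have hcongr : ∫⁻ z in unitCube d, ‖cubatureError r ξ w z u‖ₑ ^ 2 =
      ∫⁻ z in unitCube d, ‖E z‖ₑ ^ 2 := by
    refine setLIntegral_congr_fun measurableSet_unitCube fun z hz => ?_
    simp only [← hE z hz, enorm_eq_nnnorm, Complex.nnnorm_real]
  rw [hcongr, parseval_unitCube E hmemE, sqWorstCaseError]
  refine ENNReal.tsum_le_tsum fun k => ?_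
  rw [hcoef, enorm_mul, mul_pow]
  gcongr
  rw [← ofReal_norm, ← ENNReal.ofReal_pow (norm_nonneg _), norm_prod, ← Finset.prod_pow]
  simp only [decay]
  rw [← ENNReal.ofReal_prod_of_nonneg fun _ _ => by positivity]
  refine ENNReal.ofReal_le_ofReal (Finset.prod_le_prod (fun _ _ => by positivity) fun j _ => ?_)
  rw [norm_pow, ← pow_mul, mul_comm r 2, ← inv_pow]
  refine pow_le_pow_left₀ (norm_nonneg _) ?_ _
  simpa using norm_hatFT_one_intCast_le (hu0 j) (hu2 j) (-k j)

theorem periodicDiscrepancy_le {r : ℕ} (hr : 1 ≤ r) (ξ : Fin m → Fin d → ℝ)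
    (hξ : ∀ μ, ξ μ ∈ unitCube d) (w : Fin m → ℝ) :
    periodicDiscrepancy r 2 ∞ ξ w ≤ sqWorstCaseError r ξ w ^ (1 / 2 : ℝ) := by
  rw [periodicDiscrepancy, eLpNorm_exponent_top]
  refine eLpNormEssSup_le_of_ae_enorm_bound ?_
  have hm : MeasurableSet (shapeCube d) := MeasurableSet.univ_pi fun _ => measurableSet_Ioc
  filter_upwards [ae_restrict_mem hm] with u hu
  rw [enorm_eq_self, eLpNorm_eq_lintegral_rpow_enorm_toReal two_ne_zero ENNReal.ofNat_ne_top]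
  simp only [ENNReal.toReal_ofNat]
  refine ENNReal.rpow_le_rpow ?_ (by norm_num)
  simpa using lintegral_cubatureError_le hr ξ hξ w hu

end

/-! ### Admissible lattices from totally real algebraic numbers -/

section NumberTheory

open Polynomial

/-- Frolov's polynomial `∏_{i<d} (X - 4i) - 1`, which is irreducible over `ℤ` and has `d` real roots.
The zeros `4i` of the product are spaced so that it alternates in sign, with modulus at least `2^d`,
at the points `4j - 2`. -/
noncomputable def frolovPoly (d : ℕ) : ℤ[X] := ∏ i : Fin d, (X - C (4 * (i : ℤ))) - 1

variable {d : ℕ}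

lemma natDegree_prod_frolov : (∏ i : Fin d, (X - C (4 * (i : ℤ)))).natDegree = d := by
  rw [natDegree_prod_of_monic _ _ fun i _ => monic_X_sub_C _]
  simp only [natDegree_X_sub_C, Finset.sum_const, Finset.card_univ, Fintype.card_fin, smul_eq_mul,
    mul_one]

lemma degree_one_lt_prod_frolov (hd : 1 ≤ d) :
    (1 : ℤ[X]).degree < (∏ i : Fin d, (X - C (4 * (i : ℤ)))).degree := by
  rw [degree_one, degree_eq_natDegree (monic_prod_of_monic _ _ fun i _ => monic_X_sub_C _).ne_zero,
    natDegree_prod_frolov]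
  exact_mod_cast hd

lemma monic_frolovPoly (hd : 1 ≤ d) : (frolovPoly d).Monic :=
  (monic_prod_of_monic _ _ fun _ _ => monic_X_sub_C _).sub_of_left (degree_one_lt_prod_frolov hd)

lemma natDegree_frolovPoly (hd : 1 ≤ d) : (frolovPoly d).natDegree = d := by
  rw [frolovPoly, natDegree_sub_eq_left_of_natDegree_lt, natDegree_prod_frolov]
  rw [natDegree_prod_frolov]
  simpa using Nat.lt_of_lt_of_le zero_lt_one hd

lemma eval_frolovPoly (i : Fin d) : (frolovPoly d).eval (4 * (i : ℤ)) = -1 := by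
  rw [frolovPoly, eval_sub, eval_prod, Finset.prod_eq_zero (Finset.mem_univ i) (by simp)]
  simp

lemma irreducible_frolovPoly (hd : 1 ≤ d) : Irreducible (frolovPoly d) := by
  have hne : frolovPoly d ≠ 1 := by
    intro h
    have := natDegree_frolovPoly hd
    rw [h] at this
    simp at this
    omega
  refine (monic_frolovPoly hd).irreducible_iff_natDegree.2 ⟨hne, ?_⟩
  intro f g hf hg hfg
  by_contra! hcon
  have hdeg : f.natDegree + g.natDegree = d := by
    rw [← hf.natDegree_mul hg, hfg, natDegree_frolovPoly hd]
  -- The two factors take opposite values `±1` at the `d` points `4i`, so their sum vanishes there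
  have hzero : f + g = 0 := by
    refine eq_zero_of_natDegree_lt_card_of_eval_eq_zero (f + g)
      (f := fun i : Fin d => 4 * (i : ℤ)) ?_ ?_ ?_
    · intro i j hij
      simp only at hij
      exact Fin.ext (by omega)
    · intro i
      have h1 : f.eval (4 * (i : ℤ)) * g.eval (4 * (i : ℤ)) = -1 := by
        rw [← eval_mul, hfg, eval_frolovPoly]
      rcases Int.mul_eq_neg_one_iff_eq_one_or_neg_one.1 h1 with ⟨h, h'⟩ | ⟨h, h'⟩ <;>
        simp [h, h']
    · refine (natDegree_add_le f g).trans_lt ?_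
      simp only [Fintype.card_fin, max_lt_iff]
      omega
  have h1 := hf.leadingCoeff
  rw [eq_neg_of_add_eq_zero_left hzero, leadingCoeff_neg, hg.leadingCoeff] at h1
  omega

/-- The sign of `frolovPoly (j + e)` at `4j - 2` is `(-1)^e`: the `e` factors with `i ≥ j` are
negative. -/
lemma sign_frolov (j e : ℕ) (h : 1 ≤ j + e) :
    0 < (-1 : ℝ) ^ e * (∏ i ∈ Finset.range (j + e), ((4 * (j : ℝ) - 2) - 4 * (i : ℝ)) - 1) := by
  rw [Finset.prod_range_add]
  have hA : (2 : ℝ) ^ j ≤ ∏ i ∈ Finset.range j, ((4 * (j : ℝ) - 2) - 4 * (i : ℝ)) := by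
    calc (2 : ℝ) ^ j = ∏ _i ∈ Finset.range j, (2 : ℝ) := by simp
      _ ≤ _ := Finset.prod_le_prod (fun _ _ => by norm_num) fun i hi => by
        have : ((i : ℝ) + 1) ≤ j := by exact_mod_cast Finset.mem_range.1 hi
        linarith
  have hB' : ∏ i ∈ Finset.range e, ((4 * (j : ℝ) - 2) - 4 * ((j + i : ℕ) : ℝ)) =
      (-1) ^ e * ∏ i ∈ Finset.range e, (2 + 4 * (i : ℝ)) := by
    calc _ = ∏ i ∈ Finset.range e, ((-1) * (2 + 4 * (i : ℝ))) :=
          Finset.prod_congr rfl fun i _ => by push_cast; ring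
      _ = _ := by rw [Finset.prod_mul_distrib]; simp
  have hB : (2 : ℝ) ^ e ≤ ∏ i ∈ Finset.range e, (2 + 4 * (i : ℝ)) := by
    calc (2 : ℝ) ^ e = ∏ _i ∈ Finset.range e, (2 : ℝ) := by simp
      _ ≤ _ := Finset.prod_le_prod (fun _ _ => by norm_num) fun i hi => by
        have : (0 : ℝ) ≤ i := Nat.cast_nonneg i
        linarith
  rw [hB']
  set A := ∏ i ∈ Finset.range j, ((4 * (j : ℝ) - 2) - 4 * (i : ℝ))
  set B := ∏ i ∈ Finset.range e, (2 + 4 * (i : ℝ))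
  have hAB : (2 : ℝ) ≤ A * B := by
    calc (2 : ℝ) = 2 ^ 1 := by norm_num
      _ ≤ 2 ^ (j + e) := pow_le_pow_right₀ (by norm_num) h
      _ = 2 ^ j * 2 ^ e := pow_add _ _ _
      _ ≤ A * B := mul_le_mul hA hB (by positivity) ((by positivity : (0 : ℝ) ≤ 2 ^ j).trans hA)
  rcases neg_one_pow_eq_or ℝ e with h1 | h1 <;> rw [h1] <;> nlinarith

lemma aeval_frolovPoly (x : ℝ) :
    aeval x (frolovPoly d) = ∏ i ∈ Finset.range d, (x - 4 * (i : ℝ)) - 1 := by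
  rw [frolovPoly, map_sub, map_prod, map_one, Finset.prod_range]
  congr 1
  refine Finset.prod_congr rfl fun i _ => ?_
  rw [map_sub, aeval_X, aeval_C]
  simp

lemma exists_root_frolovPoly (j : Fin d) :
    ∃ x ∈ Ioo (4 * (j : ℝ) - 2) (4 * (j : ℝ) + 2), aeval x (frolovPoly d) = 0 := by
  obtain ⟨e, he⟩ : ∃ e, d = j + (e + 1) := ⟨d - j - 1, by omega⟩
  have h1 := sign_frolov j (e + 1) (by omega)
  have h2 := sign_frolov (j + 1) e (by omega)
  rw [show (j : ℕ) + 1 + e = d by omega] at h2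
  rw [← he] at h1
  have hcont : Continuous fun x : ℝ => ∏ i ∈ Finset.range d, (x - 4 * (i : ℝ)) - 1 := by fun_prop
  push_cast at h2
  rw [show 4 * ((j : ℝ) + 1) - 2 = 4 * (j : ℝ) + 2 by ring] at h2
  simp only [aeval_frolovPoly]
  have hle : 4 * (j : ℝ) - 2 ≤ 4 * (j : ℝ) + 2 := by linarith
  rw [pow_succ] at h1
  rcases neg_one_pow_eq_or ℝ e with h | h
  · rw [h] at h1 h2
    obtain ⟨x, hx, hx0⟩ := intermediate_value_Ioo hle hcont.continuousOn
      (show (0 : ℝ) ∈ _ from ⟨by linarith, by linarith⟩)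
    exact ⟨x, hx, hx0⟩
  · rw [h] at h1 h2
    obtain ⟨x, hx, hx0⟩ := intermediate_value_Ioo' hle hcont.continuousOn
      (show (0 : ℝ) ∈ _ from ⟨by linarith, by linarith⟩)
    exact ⟨x, hx, hx0⟩

/-- A root of `frolovPoly d` has degree `d` over `ℚ`, so it is not a root of a nonzero integer
polynomial of smaller degree. -/
lemma aeval_ne_zero_of_root (hd : 1 ≤ d) {x : ℝ} (hx : aeval x (frolovPoly d) = 0) {q : ℤ[X]}
    (hq : q ≠ 0) (hqd : q.natDegree < d) : aeval x q ≠ 0 := by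
  intro h0
  have hirr : Irreducible ((frolovPoly d).map (algebraMap ℤ ℚ)) :=
    ((monic_frolovPoly hd).irreducible_iff_irreducible_map_fraction_map (K := ℚ)).1
      (irreducible_frolovPoly hd)
  have hmin := minpoly.eq_of_irreducible_of_monic hirr (x := x)
    (by rwa [aeval_map_algebraMap]) ((monic_frolovPoly hd).map _)
  have hinj : Function.Injective (algebraMap ℤ ℚ) := Int.cast_injective
  have hle := minpoly.degree_le_of_ne_zero ℚ x
    (p := q.map (algebraMap ℤ ℚ)) ((Polynomial.map_ne_zero_iff hinj).2 hq)
    (by rwa [aeval_map_algebraMap])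
  rw [← hmin, degree_map_eq_of_injective hinj, degree_map_eq_of_injective hinj,
    degree_eq_natDegree (monic_frolovPoly hd).ne_zero, natDegree_frolovPoly hd] at hle
  exact absurd hqd (not_lt.2 (le_natDegree_of_coe_le_degree hle))

/-- Frolov's admissible lattice: an invertible matrix for which the product of the coordinates is at
least `1` in absolute value at each nonzero vector of the lattice that it generates. -/
theorem exists_admissible_matrix (hd : 1 ≤ d) :
    ∃ W : Matrix (Fin d) (Fin d) ℝ, W.det ≠ 0 ∧
      ∀ n : Fin d → ℤ, n ≠ 0 → 1 ≤ ∏ i, |W.mulVec (intVec n) i| := by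
  choose α hα hroot using exists_root_frolovPoly (d := d)
  have hinj : Function.Injective α := by
    intro i j hij
    have h1 := hα i
    have h2 := hα j
    rw [← hij] at h2
    have h3 : (i : ℝ) < j + 1 := by linarith [h1.1, h2.2]
    have h4 : (j : ℝ) < i + 1 := by linarith [h2.1, h1.2]
    have h3' : (i : ℕ) < j + 1 := by exact_mod_cast h3
    have h4' : (j : ℕ) < i + 1 := by exact_mod_cast h4
    exact Fin.ext (by omega)
  refine ⟨Matrix.vandermonde α, Matrix.det_vandermonde_ne_zero_iff.2 hinj, fun n hn => ?_⟩
  set q : ℤ[X] := ∑ j : Fin d, C (n j) * X ^ (j : ℕ) with hq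
  have hcoeff : ∀ j : Fin d, q.coeff j = n j := by
    intro j
    simp [hq, coeff_X_pow, Fin.val_inj]
  have hq0 : q ≠ 0 := by
    intro h
    refine hn (funext fun j => ?_)
    rw [← hcoeff j, h]
    simp
  have hqd : q.natDegree < d := by
    have : q.degree < d := (degree_sum_fin_lt fun j => n j)
    exact (natDegree_lt_iff_degree_lt hq0).2 this
  have hW : ∀ i, (Matrix.vandermonde α).mulVec (intVec n) i = aeval (α i) q := by
    intro i
    simp [hq, Matrix.mulVec, dotProduct, Matrix.vandermonde_apply, intVec, mul_comm]
  have hfac : (frolovPoly d).map (algebraMap ℤ ℝ) = ∏ i, (X - C (α i)) := by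
    have hm1 := (monic_frolovPoly hd).map (algebraMap ℤ ℝ)
    have hm2 : (∏ i, (X - C (α i))).Monic := monic_prod_of_monic _ _ fun i _ => monic_X_sub_C _
    have hdeg : (∏ i, (X - C (α i))).natDegree = d := by
      rw [natDegree_prod_of_monic _ _ fun i _ => monic_X_sub_C _]
      simp
    have hdeg1 : ((frolovPoly d).map (algebraMap ℤ ℝ)).natDegree = d := by
      rw [(monic_frolovPoly hd).natDegree_map, natDegree_frolovPoly hd]
    refine eq_of_degree_sub_lt_of_eval_finset_eq (Finset.univ.image α) ?_ ?_
    · rw [Finset.card_image_of_injective _ hinj, Finset.card_univ, Fintype.card_fin]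
      have := degree_sub_lt_left (p := (frolovPoly d).map (algebraMap ℤ ℝ))
        (q := ∏ i, (X - C (α i))) ?_ hm1.ne_zero ?_
      · rwa [degree_eq_natDegree hm1.ne_zero, hdeg1] at this
      · rw [degree_eq_natDegree hm1.ne_zero, degree_eq_natDegree hm2.ne_zero, hdeg, hdeg1]
      · rw [hm1.leadingCoeff, hm2.leadingCoeff]
    · intro x hx
      obtain ⟨i, -, rfl⟩ := Finset.mem_image.1 hx
      rw [eval_map_algebraMap, hroot i, eval_prod, Finset.prod_eq_zero (Finset.mem_univ i)]
      simp
  -- The product of the coordinates is an integer, namely a resultant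
  have hres : ∏ i, aeval (α i) q = ((frolovPoly d).resultant q d (q.natDegree) : ℤ) := by
    have := resultant_map_map (frolovPoly d) q d q.natDegree (algebraMap ℤ ℝ)
    have hp := resultant_prod_left Finset.univ (fun i => X - C (α i)) (q.map (algebraMap ℤ ℝ))
      q.natDegree (by simp) natDegree_map_le
    rw [← hfac, (monic_frolovPoly hd).natDegree_map, natDegree_frolovPoly hd, this] at hp
    simp only [natDegree_X_sub_C, resultant_X_sub_C_left _ _ _ natDegree_map_le,
      eval_map_algebraMap] at hp
    exact hp.symm
  simp only [hW]
  rw [← Finset.abs_prod, hres]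
  have hne : ((frolovPoly d).resultant q d (q.natDegree) : ℤ) ≠ 0 := by
    intro h
    rw [h, Int.cast_zero, Finset.prod_eq_zero_iff] at hres
    obtain ⟨i, -, hi⟩ := hres
    exact aeval_ne_zero_of_root hd (hroot i) hq0 hqd hi
  exact_mod_cast Int.one_le_abs hne

end NumberTheory

/-! ### Randomly shifted lattices -/

section Decay

lemma tsum_pi_prod_eq_prod_tsum {ι : Type*} {d : ℕ} (f : Fin d → ι → ℝ≥0∞) :
    ∑' k : Fin d → ι, ∏ j, f j (k j) = ∏ j, ∑' i, f j i := by
  induction d with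
  | zero => simp [tsum_fintype]
  | succ d ih =>
    rw [← (Fin.consEquiv fun _ => ι).tsum_eq, ENNReal.tsum_prod', Fin.prod_univ_succ,
      ← ih fun j => f j.succ, ← ENNReal.tsum_mul_right]
    refine tsum_congr fun i => ?_
    rw [← ENNReal.tsum_mul_left]
    refine tsum_congr fun k => ?_
    simp [Fin.consEquiv, Fin.prod_univ_succ]

lemma tsum_int_eq_tsum_nat (f : ℤ → ℝ≥0∞) :
    ∑' i : ℤ, f i = ∑' n : ℕ, f n + ∑' n : ℕ, f (-(n + 1 : ℤ)) :=
  (HasSum.of_nat_of_neg_add_one ENNReal.summable.hasSum ENNReal.summable.hasSum).tsum_eq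

lemma decay_anti {r : ℕ} {x y : ℝ} (h : |x| ≤ |y|) : decay r y ≤ decay r x := by
  refine ENNReal.ofReal_le_ofReal ?_
  gcongr

lemma tsum_decay_one_ne_top : ∑' k : ℤ, decay 1 (k : ℝ) ≠ ∞ := by
  have hs : Summable fun n : ℕ => ((1 + (n : ℝ)) ^ 2)⁻¹ := by
    have := (summable_nat_add_iff 1).2 (Real.summable_nat_pow_inv.2 one_lt_two)
    refine this.congr fun n => ?_
    push_cast
    ring
  have h1 : ∑' n : ℕ, decay 1 (n : ℝ) ≠ ∞ := by
    have := hs.tsum_ofReal_ne_top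
    simpa [decay] using this
  rw [tsum_int_eq_tsum_nat]
  refine ENNReal.add_ne_top.2 ⟨by simpa using h1, ne_top_of_le_ne_top h1 ?_⟩
  refine ENNReal.tsum_le_tsum fun n => decay_anti ?_
  push_cast
  rw [abs_neg, abs_of_nonneg (by positivity), abs_of_nonneg (by positivity)]
  linarith

lemma tsum_decay_one_add_le (y : ℝ) :
    ∑' k : ℤ, decay 1 (k + y) ≤ 4 * ∑' k : ℤ, decay 1 (k : ℝ) := by
  rw [← (Equiv.addRight ⌊y⌋).tsum_eq fun k : ℤ => decay 1 (k : ℝ), ← ENNReal.tsum_mul_left]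
  refine ENNReal.tsum_le_tsum fun k => ?_
  rw [decay, decay, show (4 : ℝ≥0∞) = ENNReal.ofReal 4 by simp,
    ← ENNReal.ofReal_mul (by norm_num)]
  refine ENNReal.ofReal_le_ofReal ?_
  have h : |((k : ℝ) + ⌊y⌋)| ≤ |k + y| + 1 := by
    have h1 : ((k : ℝ) + ⌊y⌋) = (k + y) - Int.fract y := by rw [← Int.self_sub_floor]; ring
    rw [h1]
    refine (abs_sub _ _).trans ?_
    rw [abs_of_nonneg (Int.fract_nonneg y)]
    linarith [Int.fract_lt_one y]
  simp only [Equiv.coe_addRight, Int.cast_add, mul_one]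
  rw [inv_le_iff_one_le_mul₀ (by positivity), mul_assoc, mul_comm (_⁻¹), ← mul_assoc,
    ← div_eq_mul_inv, one_le_div (by positivity)]
  nlinarith [abs_nonneg ((k : ℝ) + ⌊y⌋), abs_nonneg ((k : ℝ) + y)]

/-- Peetre's inequality `1 + |y| ≤ (1 + |k|)(1 + |k + y|)`, in terms of decay factors. -/
lemma decay_mul_decay_le (r : ℕ) (k y : ℝ) :
    decay r k * decay (r + 1) (k + y) ≤ decay r y * decay 1 (k + y) := by
  rw [decay, decay, decay, decay, ← ENNReal.ofReal_mul (by positivity),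
    ← ENNReal.ofReal_mul (by positivity)]
  refine ENNReal.ofReal_le_ofReal ?_
  rw [mul_add, pow_add, mul_inv (_ ^ (2 * r)), ← mul_assoc]
  gcongr
  rw [← mul_inv, ← mul_pow]
  gcongr
  have : |y| ≤ |k + y| + |k| := by simpa using abs_sub (k + y) k
  nlinarith [abs_nonneg (k + y), abs_nonneg k]

/-- Discrete convolution of the decay factors with the Fourier transform of the B-spline. -/
lemma exists_tsum_decay_mul_hatFT_le (r : ℕ) :
    ∃ C : ℝ≥0∞, C ≠ ∞ ∧ ∀ y : ℝ,
      ∑' k : ℤ, decay r k * ‖hatFT 1 1 (k + y) ^ (r + 1)‖ₑ ^ 2 ≤ C * decay r y := by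
  refine ⟨4 ^ (r + 1) * (4 * ∑' k : ℤ, decay 1 (k : ℝ)), ?_, fun y => ?_⟩
  · exact ENNReal.mul_ne_top (by finiteness) (ENNReal.mul_ne_top (by finiteness)
      tsum_decay_one_ne_top)
  have h1 : ∀ x : ℝ, ‖hatFT 1 1 x ^ (r + 1)‖ₑ ^ 2 ≤ 4 ^ (r + 1) * decay (r + 1) x := by
    intro x
    rw [← ofReal_norm, ← ENNReal.ofReal_pow (norm_nonneg _), decay,
      show (4 : ℝ≥0∞) = ENNReal.ofReal 4 by simp, ← ENNReal.ofReal_pow (by norm_num),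
      ← ENNReal.ofReal_mul (by positivity)]
    refine ENNReal.ofReal_le_ofReal ?_
    rw [norm_pow, ← pow_mul, mul_comm (r + 1) 2]
    refine (pow_le_pow_left₀ (norm_nonneg _) (norm_hatFT_one_one_le x) _).trans (le_of_eq ?_)
    rw [div_pow, pow_mul 2 2, div_eq_mul_inv]
    norm_num
  calc ∑' k : ℤ, decay r k * ‖hatFT 1 1 (k + y) ^ (r + 1)‖ₑ ^ 2
      ≤ ∑' k : ℤ, 4 ^ (r + 1) * decay r y * decay 1 (k + y) := by
        refine ENNReal.tsum_le_tsum fun k => ?_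
        calc decay r k * ‖hatFT 1 1 (k + y) ^ (r + 1)‖ₑ ^ 2
            ≤ decay r k * (4 ^ (r + 1) * decay (r + 1) (k + y)) := by gcongr; exact h1 _
          _ = 4 ^ (r + 1) * (decay r k * decay (r + 1) (k + y)) := by ring
          _ ≤ 4 ^ (r + 1) * (decay r y * decay 1 (k + y)) :=
              mul_le_mul' le_rfl (decay_mul_decay_le r k y)
          _ = _ := by ring
    _ = 4 ^ (r + 1) * decay r y * ∑' k : ℤ, decay 1 (k + y) := by rw [ENNReal.tsum_mul_left]
    _ ≤ 4 ^ (r + 1) * decay r y * (4 * ∑' k : ℤ, decay 1 (k : ℝ)) := by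
        gcongr; exact tsum_decay_one_add_le y
    _ = _ := by ring

end Decay

section ShiftedLattice

variable {d : ℕ}

/-- The tensor product B-spline with integer knot spacing: the hat function of order `r + 1` with all
shape parameters equal to `1`. The order makes its Fourier transform decay fast enough for
`exists_tsum_decay_mul_hatFT_le`. -/
noncomputable def bspline (r : ℕ) (x : Fin d → ℝ) : ℝ := boxHat (r + 1) x 0 1

/-- The Fourier transform of the B-spline. -/
noncomputable def bsplineFT (r : ℕ) (ξ : Fin d → ℝ) : ℂ := ∏ j, hatFT 1 1 (ξ j) ^ (r + 1)

lemma integral_chr_mul_bspline (r : ℕ) (ξ : Fin d → ℝ) :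
    ∫ x, chr ξ x * (bspline r x : ℂ) = bsplineFT r ξ :=
  integral_chr_mul_boxHat (fun _ => one_pos) (fun _ => le_rfl) (by omega) ξ

lemma integrable_bspline (r : ℕ) : Integrable fun x : Fin d → ℝ => (bspline r x : ℂ) :=
  integrable_boxHat (fun _ => one_pos) (fun _ => le_rfl) (by omega)

/-- This is the Fourier side of the partition of unity `∑ₙ bspline r (x + n) = 1`. -/
lemma bsplineFT_intVec (r : ℕ) (k : Fin d → ℤ) :
    bsplineFT r (intVec k) = if k = 0 then 1 else 0 := by
  simp only [bsplineFT, intVec, hatFT_one_one_intCast, ite_pow, one_pow, ne_eq,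
    Nat.succ_ne_zero, not_false_eq_true, zero_pow]
  rw [Finset.prod_ite_zero]
  simp [funext_iff]

lemma chr_mulVec (B : Matrix (Fin d) (Fin d) ℝ) (ξ x : Fin d → ℝ) :
    chr ξ (B.mulVec x) = chr (B.transpose.mulVec ξ) x := by
  rw [chr, chr, Matrix.dotProduct_mulVec, Matrix.mulVec_transpose]

lemma integral_comp_mulVec {M : Matrix (Fin d) (Fin d) ℝ} (hM : M.det ≠ 0)
    (f : (Fin d → ℝ) → ℂ) : ∫ x, f (M.mulVec x) = |M.det⁻¹| * ∫ x, f x := by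
  have hemb : MeasurableEmbedding (Matrix.toLin' M) := by
    have hc : Continuous (Matrix.toLin' M) := LinearMap.continuous_of_finiteDimensional _
    refine hc.measurableEmbedding ?_
    have := (LinearEquiv.ofIsUnitDet (f := Matrix.toLin' M) (v := Pi.basisFun ℝ (Fin d))
      (v' := Pi.basisFun ℝ (Fin d)) (by simpa [LinearMap.toMatrix_eq_toMatrix'] using hM)).injective
    exact this
  have h := hemb.integral_map (μ := volume) f
  rw [Real.map_matrix_volume_pi_eq_smul_volume_pi hM, integral_smul_measure] at h
  simp only [Matrix.toLin'_apply] at h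
  rw [← h, ENNReal.toReal_ofReal (abs_nonneg _), Complex.real_smul]

lemma integrable_comp_mulVec {M : Matrix (Fin d) (Fin d) ℝ} (hM : M.det ≠ 0)
    {f : (Fin d → ℝ) → ℂ} (hf : Integrable f) : Integrable fun x => f (M.mulVec x) := by
  have h1 : Integrable f (Measure.map (Matrix.toLin' M) volume) := by
    rw [Real.map_matrix_volume_pi_eq_smul_volume_pi hM]
    exact hf.smul_measure ENNReal.ofReal_ne_top
  exact h1.comp_measurable (LinearMap.continuous_of_finiteDimensional _).measurable

/-- The error on the character of frequency `k` of the cubature formula with knots `B⁻¹(s + n)`,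
`n ∈ N`, with the weights `|det B⁻¹|` times the values of the B-spline. -/
noncomputable def shiftedError (r : ℕ) (B : Matrix (Fin d) (Fin d) ℝ) (N : Finset (Fin d → ℤ))
    (k : Fin d → ℤ) (s : Fin d → ℝ) : ℂ :=
  (if k = 0 then 1 else 0) -
    ∑ n ∈ N, ((|B⁻¹.det| * bspline r (B⁻¹.mulVec (s + intVec n)) : ℝ) : ℂ) *
      chr (intVec k) (B⁻¹.mulVec (s + intVec n))

lemma measurable_bspline_mulVec (r : ℕ) (M : Matrix (Fin d) (Fin d) ℝ) :
    Measurable fun y => bspline r (M.mulVec y) :=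
  (measurable_boxHat (r + 1) 1).comp (by fun_prop : Continuous fun y => M.mulVec y).measurable

lemma measurable_shiftedError (r : ℕ) (B : Matrix (Fin d) (Fin d) ℝ) (N : Finset (Fin d → ℤ))
    (k : Fin d → ℤ) : Measurable (shiftedError r B N k) := by
  refine measurable_const.sub (Finset.measurable_fun_sum _ fun n _ => ?_)
  refine (Complex.measurable_ofReal.comp (((measurable_bspline_mulVec r B⁻¹).comp
    (measurable_id.add_const _)).const_mul _)).mul ?_
  exact (by fun_prop : Continuous fun s =>
    chr (intVec k) (B⁻¹.mulVec (s + intVec n))).measurable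

/-- Averaging over the shift: by Parseval's identity in `s` and unfolding, the mean square error on
a character is a sum of values of `|bsplineFT|²` over the nonzero points of the dual lattice. -/
lemma lintegral_shiftedError (r : ℕ) {B : Matrix (Fin d) (Fin d) ℝ} (hB : B.det ≠ 0)
    {N : Finset (Fin d → ℤ)}
    (hN : ∀ s ∈ unitCube d, ∀ n ∉ N, bspline r (B⁻¹.mulVec (s + intVec n)) = 0)
    (k : Fin d → ℤ) :
    ∫⁻ s in unitCube d, ‖shiftedError r B N k s‖ₑ ^ 2 =
      ∑' l : Fin d → ℤ, if l = 0 then 0 else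
        ‖bsplineFT r (intVec k + B.transpose.mulVec (intVec l))‖ₑ ^ 2 := by
  have hdet : B⁻¹.det ≠ 0 := by
    rw [Matrix.det_nonsing_inv, Ring.inverse_eq_inv']
    exact inv_ne_zero hB
  have hunit : IsUnit B.det := isUnit_iff_ne_zero.2 hB
  let G : (Fin d → ℤ) → (Fin d → ℝ) → ℂ := fun l y =>
    chr (intVec l) y * (((|B⁻¹.det| * bspline r (B⁻¹.mulVec y) : ℝ) : ℂ) *
      chr (intVec k) (B⁻¹.mulVec y))
  let f : (Fin d → ℤ) → (Fin d → ℝ) → ℂ := fun l x =>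
    |B⁻¹.det| * (chr (intVec k + B.transpose.mulVec (intVec l)) x * (bspline r x : ℂ))
  have hGf : ∀ l y, G l y = f l (B⁻¹.mulVec y) := by
    intro l y
    simp only [G, f]
    rw [chr_add_left, ← chr_mulVec, Matrix.mulVec_mulVec, Matrix.mul_nonsing_inv B hunit,
      Matrix.one_mulVec]
    push_cast
    ring
  have hf : ∀ l, Integrable (f l) := by
    intro l
    refine ((integrable_bspline r).bdd_mul (c := 1) (continuous_chr _).aestronglyMeasurable
      (Filter.Eventually.of_forall fun y => by simp)).const_mul _
  have hG : ∀ l, Integrable (G l) := by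
    intro l
    rw [show G l = fun y => f l (B⁻¹.mulVec y) from funext (hGf l)]
    exact integrable_comp_mulVec hdet (hf l)
  have hGint : ∀ l, ∫ y, G l y = bsplineFT r (intVec k + B.transpose.mulVec (intVec l)) := by
    intro l
    simp only [hGf]
    rw [integral_comp_mulVec hdet, integral_const_mul, integral_chr_mul_bspline, ← mul_assoc,
      ← Complex.ofReal_mul, ← abs_mul, inv_mul_cancel₀ hdet]
    simp
  have hmem : MemLp (shiftedError r B N k) 2 (volume.restrict (unitCube d)) := by
    refine MemLp.of_bound (C := 1 + ∑ n ∈ N, |B⁻¹.det|)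
      (measurable_shiftedError r B N k).aestronglyMeasurable
      (Filter.Eventually.of_forall fun s => ?_)
    refine (norm_sub_le _ _).trans (add_le_add ?_ ?_)
    · split_ifs <;> simp
    · refine (norm_sum_le _ _).trans (Finset.sum_le_sum fun n _ => ?_)
      rw [norm_mul, norm_chr, mul_one, Complex.norm_real, norm_mul,
        Real.norm_of_nonneg (abs_nonneg _)]
      exact mul_le_of_le_one_right (abs_nonneg _)
        (abs_boxHat_le_one (fun _ => one_pos) (fun _ => le_rfl) (by omega) _ _)
  rw [parseval_unitCube _ hmem]
  refine tsum_congr fun l => ?_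
  have hcoef : ∫ s in unitCube d, chr (intVec l) s * shiftedError r B N k s =
      (if k = 0 then 1 else 0) * (if l = 0 then 1 else 0) -
        bsplineFT r (intVec k + B.transpose.mulVec (intVec l)) := by
    have h1 : ∀ s, chr (intVec l) s * shiftedError r B N k s =
        (if k = 0 then 1 else 0) * chr (intVec l) s - ∑ n ∈ N, G l (s + intVec n) := by
      intro s
      simp only [shiftedError, G, chr_intVec_add_intVec, ← Finset.mul_sum]
      ring
    have hchr : Integrable (fun z => chr (intVec l) z) (volume.restrict (unitCube d)) :=
      (MemLp.of_bound (C := 1) (p := 1) (continuous_chr _).aestronglyMeasurable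
        (Filter.Eventually.of_forall fun z => by simp)).integrable le_rfl
    simp only [h1]
    rw [integral_sub (hchr.const_mul _)
      (integrable_finsetSum _ fun n _ => ((hG l).comp_add_right (intVec n)).integrableOn),
      integral_const_mul, setIntegral_unitCube_chr, setIntegral_sum_translates (G l) (hG l) N,
      hGint]
    intro s hs n hn
    simp only [G, hN s hs n hn]
    simp
  rw [hcoef]
  by_cases hl : l = 0
  · rw [if_pos hl, if_pos hl, hl, intVec_zero, Matrix.mulVec_zero, add_zero, bsplineFT_intVec]
    simp
  · simp [hl]

end ShiftedLattice

/-! ### Sums over the points of an admissible lattice -/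

section Counting

/-- The summand is at most the difference of consecutive values of `1 / (a (1 + n a))`. -/
lemma tsum_inv_sq_le {a : ℝ} (ha : 0 < a) :
    ∑' n : ℕ, ENNReal.ofReal (((1 + (n + 1) * a) ^ 2)⁻¹) ≤ ENNReal.ofReal (1 / a) := by
  refine ENNReal.tsum_le_of_sum_range_le fun N => ?_
  rw [← ENNReal.ofReal_sum_of_nonneg fun _ _ => by positivity]
  refine ENNReal.ofReal_le_ofReal ?_
  have h : ∑ n ∈ Finset.range N, ((1 + ((n : ℝ) + 1) * a) ^ 2)⁻¹ ≤
      1 / a * (1 - (1 + N * a)⁻¹) := by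
    induction N with
    | zero => simp
    | succ N ih =>
      rw [Finset.sum_range_succ]
      have h1 : ((1 + ((N : ℝ) + 1) * a) ^ 2)⁻¹ ≤
          1 / a * ((1 + N * a)⁻¹ - (1 + ((N : ℝ) + 1) * a)⁻¹) := by
        have e : 1 / a * ((1 + N * a)⁻¹ - (1 + ((N : ℝ) + 1) * a)⁻¹) =
            ((1 + N * a) * (1 + ((N : ℝ) + 1) * a))⁻¹ := by
          field_simp
          ring
        rw [e, pow_two]
        gcongr
        linarith
      push_cast
      linarith
  refine h.trans (mul_le_of_le_one_right (by positivity) ?_)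
  have : (0 : ℝ) ≤ (1 + N * a)⁻¹ := by positivity
  linarith

/-- The sum of the decay factors over a punctured arithmetic progression of step `v c` is at most a
constant times `v^{-2r}` for large `v` and `v^{1-2r}` for small `v`. -/
lemma mul_tsum_decay_progression_le {r : ℕ} (hr : 1 ≤ r) {c v : ℝ} (hc : 0 < c) (hc1 : c ≤ 1)
    (hv : 0 < v) :
    ENNReal.ofReal (v ^ (2 * r)) * ∑' i : ℤ, (if i = 0 then 0 else decay r (i * (v * c))) ≤
      ENNReal.ofReal (8 * (c⁻¹) ^ (2 * r)) * ENNReal.ofReal (min 1 v) := by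
  have hsum : ∑' i : ℤ, (if i = 0 then 0 else decay r (i * (v * c))) =
      2 * ∑' n : ℕ, decay r (((n : ℝ) + 1) * (v * c)) := by
    rw [tsum_int_eq_tsum_nat, tsum_eq_zero_add' ENNReal.summable, two_mul]
    have h1 : ∀ n : ℕ, (n : ℤ) + 1 ≠ 0 := fun n => by omega
    have h2 : ∀ n : ℕ, -((n : ℤ) + 1) ≠ 0 := fun n => by omega
    simp only [Nat.cast_zero, if_true, zero_add, Nat.cast_add, Nat.cast_one, h1, h2, if_false]
    congr 1
    · simp
    · refine tsum_congr fun n => ?_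
      simp only [decay]
      push_cast
      rw [neg_mul, abs_neg]
  have hterm : ∀ n : ℕ, ENNReal.ofReal (v ^ (2 * r)) * decay r (((n : ℝ) + 1) * (v * c)) =
      ENNReal.ofReal ((v / (1 + ((n : ℝ) + 1) * (v * c))) ^ (2 * r)) := by
    intro n
    rw [decay, ← ENNReal.ofReal_mul (by positivity), abs_of_pos (by positivity), div_pow,
      div_eq_mul_inv]
  rw [hsum, mul_left_comm, ← ENNReal.tsum_mul_left]
  simp only [hterm]
  have hc1' : 1 ≤ c⁻¹ := (one_le_inv₀ hc).2 hc1
  have hcp : c⁻¹ ≤ c⁻¹ ^ (2 * r) := le_self_pow₀ hc1' (by omega)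
  -- The bound by a constant.
  have hA : ∑' n : ℕ, ENNReal.ofReal ((v / (1 + ((n : ℝ) + 1) * (v * c))) ^ (2 * r)) ≤
      ENNReal.ofReal (4 * c⁻¹ ^ (2 * r)) := by
    calc ∑' n : ℕ, ENNReal.ofReal ((v / (1 + ((n : ℝ) + 1) * (v * c))) ^ (2 * r))
        ≤ ∑' n : ℕ, ENNReal.ofReal (4 * c⁻¹ ^ (2 * r)) *
            ENNReal.ofReal (((1 + ((n : ℝ) + 1) * 1) ^ 2)⁻¹) := by
          refine ENNReal.tsum_le_tsum fun n => ?_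
          rw [← ENNReal.ofReal_mul (by positivity)]
          refine ENNReal.ofReal_le_ofReal ?_
          have h1 : v / (1 + ((n : ℝ) + 1) * (v * c)) ≤ c⁻¹ * ((n : ℝ) + 1)⁻¹ := by
            rw [← mul_inv, div_le_iff₀ (by positivity), ← div_eq_inv_mul,
              le_div_iff₀ (by positivity)]
            linarith
          refine (pow_le_pow_left₀ (by positivity) h1 _).trans ?_
          rw [mul_pow, mul_comm (4 : ℝ), mul_assoc]
          gcongr
          have h2 : (((n : ℝ) + 1)⁻¹) ^ (2 * r) ≤ (((n : ℝ) + 1)⁻¹) ^ 2 :=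
            pow_le_pow_of_le_one (by positivity) (inv_le_one_of_one_le₀ (by
              have : (0 : ℝ) ≤ n := Nat.cast_nonneg n
              linarith)) (by omega)
          refine h2.trans ?_
          rw [inv_pow, ← div_eq_mul_inv, inv_eq_one_div,
            div_le_div_iff₀ (by positivity) (by positivity)]
          have : (0 : ℝ) ≤ n := Nat.cast_nonneg n
          nlinarith
      _ ≤ ENNReal.ofReal (4 * c⁻¹ ^ (2 * r)) * ENNReal.ofReal (1 / 1) := by
          rw [ENNReal.tsum_mul_left]
          gcongr
          exact tsum_inv_sq_le one_pos
      _ = _ := by simp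
  -- The bound that is linear in `v`, for small `v`.
  have hB : v ≤ 1 → ∑' n : ℕ, ENNReal.ofReal ((v / (1 + ((n : ℝ) + 1) * (v * c))) ^ (2 * r)) ≤
      ENNReal.ofReal (4 * c⁻¹ ^ (2 * r) * v) := by
    intro hv1
    calc ∑' n : ℕ, ENNReal.ofReal ((v / (1 + ((n : ℝ) + 1) * (v * c))) ^ (2 * r))
        ≤ ∑' n : ℕ, ENNReal.ofReal (v ^ 2) *
            ENNReal.ofReal (((1 + ((n : ℝ) + 1) * (v * c)) ^ 2)⁻¹) := by
          refine ENNReal.tsum_le_tsum fun n => ?_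
          rw [← ENNReal.ofReal_mul (by positivity)]
          refine ENNReal.ofReal_le_ofReal ?_
          rw [← div_eq_mul_inv, ← div_pow]
          refine pow_le_pow_of_le_one (by positivity) ?_ (by omega)
          rw [div_le_one (by positivity)]
          have : 0 ≤ ((n : ℝ) + 1) * (v * c) := by positivity
          linarith
      _ ≤ ENNReal.ofReal (v ^ 2) * ENNReal.ofReal (1 / (v * c)) := by
          rw [ENNReal.tsum_mul_left]
          gcongr
          exact tsum_inv_sq_le (by positivity)
      _ ≤ _ := by
          rw [← ENNReal.ofReal_mul (by positivity)]
          refine ENNReal.ofReal_le_ofReal ?_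
          have e : v ^ 2 * (1 / (v * c)) = c⁻¹ * v := by field_simp
          rw [e]
          have : 0 ≤ c⁻¹ ^ (2 * r) := by positivity
          gcongr
          linarith
  rw [show (8 : ℝ) * c⁻¹ ^ (2 * r) = 2 * (4 * c⁻¹ ^ (2 * r)) by ring,
    ENNReal.ofReal_mul (by norm_num), ENNReal.ofReal_ofNat, mul_assoc]
  gcongr
  rcases le_total v 1 with h | h
  · rw [min_eq_right h, ← ENNReal.ofReal_mul (by positivity)]
    exact hB h
  · rw [min_eq_left h, ENNReal.ofReal_one, mul_one]
    exact hA

/-- Comparison of a sum over points with gaps at least `δ`, all at distance at least `δ` from the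
origin, with a sum over a progression. -/
lemma tsum_decay_separated_le {ι : Type*} (r : ℕ) (y : ι → ℝ) {δ : ℝ} (hδ : 0 < δ)
    (hsep : ∀ i j, i ≠ j → δ ≤ |y i - y j|) (h0 : ∀ i, δ ≤ |y i|) :
    ∑' i, decay r (y i) ≤ ∑' k : ℤ, if k = 0 then 0 else decay r (k * (δ / 2)) := by
  have hfl : ∀ i, (⌊y i / δ⌋ : ℝ) * δ ≤ y i ∧ y i < ((⌊y i / δ⌋ : ℝ) + 1) * δ := fun i =>
    ⟨(le_div_iff₀ hδ).1 (Int.floor_le _), (div_lt_iff₀ hδ).1 (Int.lt_floor_add_one _)⟩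
  have hinj : Function.Injective fun i => ⌊y i / δ⌋ := by
    intro i j hij
    by_contra hne
    have h1 := hfl i
    have h2 := hfl j
    simp only at hij
    rw [hij] at h1
    have h3 := hsep i j hne
    have : |y i - y j| < δ := by
      rw [abs_lt]
      constructor <;> nlinarith
    linarith
  refine le_trans ?_ (ENNReal.tsum_comp_le_tsum_of_injective hinj _)
  refine ENNReal.tsum_le_tsum fun i => ?_
  obtain ⟨h1, h2⟩ := hfl i
  have h3 := h0 i
  generalize ⌊y i / δ⌋ = k at h1 h2
  have hk : k ≠ 0 := by
    rintro rfl
    simp only [Int.cast_zero, zero_mul, zero_add, one_mul] at h1 h2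
    rw [abs_of_nonneg h1] at h3
    linarith
  rw [if_neg hk]
  refine decay_anti ?_
  rw [abs_mul, abs_of_pos (half_pos hδ)]
  rcases lt_or_gt_of_ne hk with hk | hk
  · have hk1 : (k : ℝ) ≤ -1 := by exact_mod_cast Int.le_sub_one_of_lt hk
    rw [abs_of_nonpos (by linarith : (k : ℝ) ≤ 0)]
    have h4 : -y i ≤ |y i| := neg_le_abs _
    rcases eq_or_lt_of_le hk1 with h | h
    · rw [h]; linarith
    · have hk2 : (k : ℝ) ≤ -2 := by
        have : k < -1 := by exact_mod_cast h
        exact_mod_cast (by omega : k ≤ -2)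
      nlinarith
  · have hk1 : (1 : ℝ) ≤ k := by exact_mod_cast hk
    rw [abs_of_nonneg (by linarith : (0 : ℝ) ≤ k)]
    have h4 : y i ≤ |y i| := le_abs_self _
    nlinarith

/-- The dyadic level of `y`: the integer `s ≥ 0` with `2^s ≤ 1 + |y| < 2^{s+1}`. -/
noncomputable def dyadicLevel (y : ℝ) : ℕ := Nat.log 2 ⌊1 + |y|⌋₊

lemma two_pow_dyadicLevel_le (y : ℝ) : (2 : ℝ) ^ dyadicLevel y ≤ 1 + |y| := by
  have h1 : ⌊1 + |y|⌋₊ ≠ 0 := by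
    have : 1 ≤ ⌊1 + |y|⌋₊ := Nat.le_floor (by simp)
    omega
  have h2 : ((2 ^ dyadicLevel y : ℕ) : ℝ) ≤ ⌊1 + |y|⌋₊ := by
    exact_mod_cast Nat.pow_log_le_self 2 h1
  push_cast at h2
  exact h2.trans (Nat.floor_le (by positivity))

lemma abs_lt_two_pow_dyadicLevel (y : ℝ) : |y| < 2 ^ (dyadicLevel y + 1) := by
  have h1 : ⌊1 + |y|⌋₊ + 1 ≤ 2 ^ (dyadicLevel y + 1) := Nat.lt_pow_succ_log_self one_lt_two _
  have h2 : ((⌊1 + |y|⌋₊ : ℝ) + 1) ≤ 2 ^ (dyadicLevel y + 1) := by exact_mod_cast h1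
  have := Nat.lt_floor_add_one (1 + |y|)
  linarith

lemma decay_le_dyadicLevel (r : ℕ) (y : ℝ) :
    decay r y ≤ ENNReal.ofReal (((2 ^ dyadicLevel y) ^ (2 * r))⁻¹) := by
  refine ENNReal.ofReal_le_ofReal ?_
  gcongr
  exact two_pow_dyadicLevel_le y

/-- Sum of the mixed decay factors over the nonzero points of an admissible lattice. All coordinates
but the first are localized dyadically, and then the first coordinates are well separated. -/
lemma tsum_decay_admissible_le {r : ℕ} (hr : 1 ≤ r) {e : ℕ}
    (l : (Fin (e + 1) → ℤ) → Fin (e + 1) → ℝ) (hl0 : l 0 = 0) {X : ℝ} (hX : 0 < X)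
    (hl : ∀ n n', n ≠ n' → X ≤ ∏ j, |l n j - l n' j|) :
    ∑' n, (if n = 0 then 0 else ∏ j, decay r (l n j)) ≤
      ENNReal.ofReal (8 * (2 * 4 ^ e) ^ (2 * r)) * ENNReal.ofReal ((X ^ (2 * r))⁻¹) *
        ∑' s : Fin e → ℕ, ENNReal.ofReal (min 1 (X / 2 ^ ∑ j, s j)) := by
  classical
  let σ : (Fin (e + 1) → ℤ) → Fin e → ℕ := fun n j => dyadicLevel (l n j.succ)
  have hsplit : ∑' n, (if n = 0 then 0 else ∏ j, decay r (l n j)) =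
      ∑' s : Fin e → ℕ, ∑' n,
        if s = σ n then (if n = 0 then 0 else ∏ j, decay r (l n j)) else 0 := by
    rw [ENNReal.tsum_comm]
    refine tsum_congr fun n => ?_
    rw [tsum_ite_eq]
  rw [hsplit, ← ENNReal.tsum_mul_left]
  refine ENNReal.tsum_le_tsum fun s => ?_
  set S : Set (Fin (e + 1) → ℤ) := {n | n ≠ 0 ∧ s = σ n} with hS
  have h1 : ∑' n, (if s = σ n then (if n = 0 then 0 else ∏ j, decay r (l n j)) else 0) =
      ∑' n : S, ∏ j, decay r (l n j) := by
    rw [tsum_subtype S fun n => ∏ j, decay r (l n j)]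
    refine tsum_congr fun n => ?_
    by_cases h : s = σ n <;> by_cases h' : n = 0 <;> simp [hS, indicator, h, h']
  rw [h1]
  set P : ℝ := 2 ^ ∑ j, s j with hP
  have hPpos : 0 < P := by positivity
  have h2 : ∀ n : S, ∏ j, decay r (l n j) ≤
      ENNReal.ofReal ((P ^ (2 * r))⁻¹) * decay r (l n 0) := by
    rintro ⟨n, -, hn⟩
    rw [Fin.prod_univ_succ, mul_comm]
    gcongr
    calc ∏ j : Fin e, decay r (l n j.succ)
        ≤ ∏ j : Fin e, ENNReal.ofReal (((2 ^ s j) ^ (2 * r))⁻¹) := by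
          refine Finset.prod_le_prod' fun j _ => ?_
          rw [hn]
          exact decay_le_dyadicLevel r _
      _ = _ := by
          rw [← ENNReal.ofReal_prod_of_nonneg fun _ _ => by positivity, Finset.prod_inv_distrib,
            Finset.prod_pow, Finset.prod_pow_eq_pow_sum]
  set v : ℝ := X / P with hv
  have hvpos : 0 < v := by positivity
  set c : ℝ := (2 * 4 ^ e)⁻¹ with hc
  have hcpos : 0 < c := by positivity
  have hc1 : c ≤ 1 := by
    refine inv_le_one_of_one_le₀ ?_
    have : (1 : ℝ) ≤ 4 ^ e := one_le_pow₀ (by norm_num)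
    linarith
  have hgap : ∀ n n' : Fin (e + 1) → ℤ, n ≠ n' →
      (∀ j : Fin e, |l n j.succ - l n' j.succ| ≤ 2 ^ s j * 4) →
      2 * (v * c) ≤ |l n 0 - l n' 0| := by
    intro n n' hne hj
    have h3 := hl n n' hne
    rw [Fin.prod_univ_succ] at h3
    have h4 : ∏ j : Fin e, |l n j.succ - l n' j.succ| ≤ P * 4 ^ e := by
      calc _ ≤ ∏ j : Fin e, ((2 : ℝ) ^ s j * 4) :=
            Finset.prod_le_prod (fun _ _ => abs_nonneg _) fun j _ => hj j
        _ = _ := by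
            rw [Finset.prod_mul_distrib, Finset.prod_pow_eq_pow_sum]
            simp [hP]
    have h5 : X ≤ |l n 0 - l n' 0| * (P * 4 ^ e) :=
      h3.trans (mul_le_mul_of_nonneg_left h4 (abs_nonneg _))
    have e1 : 2 * (v * c) = X / (P * 4 ^ e) := by
      rw [hv, hc]
      field_simp
    rw [e1, div_le_iff₀ (by positivity)]
    exact h5
  have hlev : ∀ n : S, ∀ j : Fin e, |l n j.succ| < 2 ^ s j * 2 := by
    rintro ⟨n, -, hn⟩ j
    have := abs_lt_two_pow_dyadicLevel (l n j.succ)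
    have hj : s j = dyadicLevel (l n j.succ) := congrFun hn j
    rw [pow_succ, ← hj] at this
    exact this
  have h3 : ∑' n : S, decay r (l n 0) ≤
      ∑' k : ℤ, if k = 0 then 0 else decay r (k * (v * c)) := by
    have := tsum_decay_separated_le r (fun n : S => l n 0) (δ := 2 * (v * c)) (by positivity) ?_ ?_
    · simpa [mul_div_cancel_left₀] using this
    · intro n n' hne
      refine hgap n n' (fun h => hne (Subtype.ext h)) fun j => ?_
      refine (abs_sub _ _).trans ?_
      linarith [hlev n j, hlev n' j]
    · intro n
      have := hgap n 0 n.2.1 fun j => ?_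
      · simpa [hl0] using this
      · rw [hl0, Pi.zero_apply, sub_zero]
        have : (0 : ℝ) < 2 ^ s j := by positivity
        linarith [hlev n j]
  calc ∑' n : S, ∏ j, decay r (l n j)
      ≤ ∑' n : S, ENNReal.ofReal ((P ^ (2 * r))⁻¹) * decay r (l n 0) := ENNReal.tsum_le_tsum h2
    _ ≤ ENNReal.ofReal ((P ^ (2 * r))⁻¹) *
        ∑' k : ℤ, (if k = 0 then 0 else decay r (k * (v * c))) := by
        rw [ENNReal.tsum_mul_left]
        gcongr
    _ = ENNReal.ofReal ((X ^ (2 * r))⁻¹) * (ENNReal.ofReal (v ^ (2 * r)) *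
        ∑' k : ℤ, (if k = 0 then 0 else decay r (k * (v * c)))) := by
        rw [← mul_assoc, ← ENNReal.ofReal_mul (by positivity), hv, div_pow]
        congr 2
        field_simp
    _ ≤ ENNReal.ofReal ((X ^ (2 * r))⁻¹) *
        (ENNReal.ofReal (8 * (c⁻¹) ^ (2 * r)) * ENNReal.ofReal (min 1 v)) :=
        mul_le_mul' le_rfl (mul_tsum_decay_progression_le hr hcpos hc1 hvpos)
    _ = _ := by
        rw [hc, inv_inv]
        ring

lemma tsum_eq_sum_add_tsum_nat_add (f : ℕ → ℝ≥0∞) (k : ℕ) :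
    ∑' i, f i = ∑ i ∈ Finset.range k, f i + ∑' i, f (i + k) :=
  (ENNReal.summable.sum_add_tsum_nat_add' (f := f)).symm

lemma exists_tsum_min_rpow_le {p : ℝ} (hp : 0 < p) :
    ∃ C : ℝ, 0 < C ∧ ∀ X : ℝ, 1 ≤ X →
      ∑' s : ℕ, ENNReal.ofReal (min 1 (X / 2 ^ s) ^ p) ≤ ENNReal.ofReal (C * (1 + Real.log X)) := by
  set q : ℝ := (1 / 2 : ℝ) ^ p with hq
  have hq0 : 0 ≤ q := by positivity
  have hq1 : q < 1 := Real.rpow_lt_one (by norm_num) (by norm_num) hp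
  have hlog2 : 0 < Real.log 2 := Real.log_pos one_lt_two
  have hq2 : 0 < (1 - q)⁻¹ := inv_pos.2 (by linarith)
  refine ⟨(Real.log 2)⁻¹ + 1 + (1 - q)⁻¹, by positivity, fun X hX => ?_⟩
  have hlogX : 0 ≤ Real.log X := Real.log_nonneg hX
  set s₀ := ⌈Real.logb 2 X⌉₊ with hs₀
  have hX2 : X ≤ 2 ^ s₀ := by
    rw [← Real.rpow_natCast, ← Real.logb_le_iff_le_rpow one_lt_two (by linarith)]
    exact Nat.le_ceil _
  have hs₀le : (s₀ : ℝ) ≤ (Real.log 2)⁻¹ * Real.log X + 1 := by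
    have : Real.logb 2 X = (Real.log 2)⁻¹ * Real.log X := by
      rw [Real.logb]; field_simp
    rw [← this]
    exact (Nat.ceil_lt_add_one (Real.logb_nonneg one_lt_two hX)).le
  have hhead : ∑ s ∈ Finset.range s₀, ENNReal.ofReal (min 1 (X / 2 ^ s) ^ p) ≤
      ENNReal.ofReal s₀ := by
    calc _ ≤ ∑ _s ∈ Finset.range s₀, (1 : ℝ≥0∞) := by
          refine Finset.sum_le_sum fun s _ => ?_
          rw [ENNReal.ofReal_le_one]
          exact Real.rpow_le_one (by positivity) (min_le_left _ _) hp.le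
      _ = _ := by simp
  have htail : ∑' s : ℕ, ENNReal.ofReal (min 1 (X / 2 ^ (s + s₀)) ^ p) ≤
      ENNReal.ofReal (1 - q)⁻¹ := by
    rw [← tsum_geometric_of_lt_one hq0 hq1,
      ENNReal.ofReal_tsum_of_nonneg (fun _ => by positivity) (summable_geometric_of_lt_one hq0 hq1)]
    refine ENNReal.tsum_le_tsum fun s => ENNReal.ofReal_le_ofReal ?_
    have h1 : min 1 (X / 2 ^ (s + s₀)) ≤ (1 / 2) ^ s := by
      refine (min_le_right _ _).trans ?_
      rw [pow_add, div_le_iff₀ (by positivity), one_div, inv_pow,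
        inv_mul_cancel_left₀ (by positivity)]
      exact hX2
    refine (Real.rpow_le_rpow (by positivity) h1 hp.le).trans (le_of_eq ?_)
    rw [hq, ← Real.rpow_natCast, ← Real.rpow_natCast, ← Real.rpow_mul (by norm_num),
      ← Real.rpow_mul (by norm_num), mul_comm]
  rw [tsum_eq_sum_add_tsum_nat_add _ s₀]
  refine (add_le_add hhead htail).trans ?_
  rw [← ENNReal.ofReal_add (by positivity) hq2.le]
  refine ENNReal.ofReal_le_ofReal ?_
  have h3 : (Real.log 2)⁻¹ * 1 ≤ (Real.log 2)⁻¹ * (1 + Real.log X) := by gcongr; linarith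
  nlinarith [inv_pos.2 hlog2]

/-- The number of dyadic boxes of volume at most `X`, up to a geometrically decaying tail. The
summand is at most `∏ⱼ min(1, X / 2^{sⱼ})^{1/(e+1)}`, so the sum is bounded by a product. -/
lemma exists_tsum_min_le (e : ℕ) :
    ∃ C : ℝ, 0 < C ∧ ∀ X : ℝ, 1 ≤ X →
      ∑' s : Fin e → ℕ, ENNReal.ofReal (min 1 (X / 2 ^ ∑ j, s j)) ≤
        ENNReal.ofReal (C * (1 + Real.log X)) ^ e := by
  set p : ℝ := 1 / ((e : ℝ) + 1) with hp
  have hp0 : 0 < p := by positivity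
  obtain ⟨C, hC, h⟩ := exists_tsum_min_rpow_le hp0
  refine ⟨C, hC, fun X hX => ?_⟩
  calc ∑' s : Fin e → ℕ, ENNReal.ofReal (min 1 (X / 2 ^ ∑ j, s j))
      ≤ ∑' s : Fin e → ℕ, ∏ j, ENNReal.ofReal (min 1 (X / 2 ^ s j) ^ p) := by
        refine ENNReal.tsum_le_tsum fun s => ?_
        rw [← ENNReal.ofReal_prod_of_nonneg fun _ _ => by positivity]
        refine ENNReal.ofReal_le_ofReal ?_
        set y := min 1 (X / 2 ^ ∑ j, s j) with hy
        have hy0 : 0 < y := lt_min one_pos (by positivity)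
        have hy1 : y ≤ 1 := min_le_left _ _
        calc y = y ^ (1 : ℝ) := (Real.rpow_one y).symm
          _ ≤ y ^ (p * e) := by
              refine Real.rpow_le_rpow_of_exponent_ge hy0 hy1 ?_
              rw [hp, one_div_mul_eq_div, div_le_one (by positivity)]
              linarith
          _ = ∏ _j : Fin e, y ^ p := by
              rw [Finset.prod_const, Finset.card_univ, Fintype.card_fin, Real.rpow_mul hy0.le,
                Real.rpow_natCast]
          _ ≤ _ := by
              refine Finset.prod_le_prod (fun _ _ => by positivity) fun j _ => ?_
              refine Real.rpow_le_rpow hy0.le ?_ hp0.le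
              refine min_le_min le_rfl ?_
              have : s j ≤ ∑ i, s i := Finset.single_le_sum (fun _ _ => Nat.zero_le _)
                (Finset.mem_univ j)
              gcongr
              norm_num
    _ = (∑' s : ℕ, ENNReal.ofReal (min 1 (X / 2 ^ s) ^ p)) ^ e := by
        rw [tsum_pi_prod_eq_prod_tsum fun (_ : Fin e) (i : ℕ) =>
          ENNReal.ofReal (min 1 (X / 2 ^ i) ^ p)]
        simp
    _ ≤ _ := by gcongr; exact h X hX

end Counting

/-! ### Cubature formulas of optimal order -/

section Average

variable {d : ℕ}

/-- Only the points `s + n` with `n` in a box whose size is governed by the row sums of `B` have an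
image under `B⁻¹` in the support of the B-spline. -/
lemma bspline_inv_mulVec_eq_zero (r : ℕ) {B : Matrix (Fin d) (Fin d) ℝ} (hB : B.det ≠ 0) {R : ℕ}
    (hR : ∀ i, (∑ j, |B i j|) * (((r : ℝ) + 1) / 2) + 1 ≤ R) {s : Fin d → ℝ} (hs : s ∈ unitCube d)
    {n : Fin d → ℤ} (hn : n ∉ intBox d R) : bspline r (B⁻¹.mulVec (s + intVec n)) = 0 := by
  obtain ⟨i, hi⟩ := notMem_intBox.1 hn
  set x := B⁻¹.mulVec (s + intVec n) with hx
  by_cases h : ∃ j, ((r : ℝ) + 1) / 2 < |x j|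
  · obtain ⟨j, hj⟩ := h
    exact boxHat_eq_zero (fun _ => le_rfl) (by omega) (j := j) (by push_cast; exact hj)
  · push Not at h
    exfalso
    have hBx : B.mulVec x = s + intVec n := by
      rw [hx, Matrix.mulVec_mulVec, Matrix.mul_nonsing_inv B (isUnit_iff_ne_zero.2 hB),
        Matrix.one_mulVec]
    have h1 : |B.mulVec x i| ≤ (∑ j, |B i j|) * (((r : ℝ) + 1) / 2) := by
      rw [Matrix.mulVec, dotProduct, Finset.sum_mul]
      refine (Finset.abs_sum_le_sum_abs _ _).trans (Finset.sum_le_sum fun j _ => ?_)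
      rw [abs_mul]
      exact mul_le_mul_of_nonneg_left (h j) (abs_nonneg _)
    rw [hBx] at h1
    have h2 : |(n i : ℝ)| ≤ |(s + intVec n) i| + |s i| := by
      simpa [intVec] using abs_sub (s i + n i) (s i)
    have h3 : |s i| ≤ 1 := by
      have := hs i (mem_univ i)
      rw [abs_of_nonneg this.1]
      exact this.2.le
    have h4 : (R : ℝ) < |(n i : ℝ)| := by exact_mod_cast hi
    linarith [hR i]

/-- The average over the shift of the square of the worst-case error is controlled by a sum over the
nonzero points of the dual lattice. -/
lemma exists_lintegral_tsum_shiftedError_le (d r : ℕ) :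
    ∃ C : ℝ≥0∞, C ≠ ∞ ∧ ∀ (B : Matrix (Fin d) (Fin d) ℝ), B.det ≠ 0 →
      ∀ N : Finset (Fin d → ℤ),
      (∀ s ∈ unitCube d, ∀ n ∉ N, bspline r (B⁻¹.mulVec (s + intVec n)) = 0) →
      ∫⁻ s in unitCube d, ∑' k : Fin d → ℤ, (∏ j, decay r (k j)) * ‖shiftedError r B N k s‖ₑ ^ 2 ≤
        C * ∑' l : Fin d → ℤ, if l = 0 then 0 else
          ∏ j, decay r (B.transpose.mulVec (intVec l) j) := by
  obtain ⟨C, hC, h⟩ := exists_tsum_decay_mul_hatFT_le r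
  refine ⟨C ^ d, by finiteness, fun B hB N hN => ?_⟩
  have hmeas : ∀ k, Measurable fun s => ‖shiftedError r B N k s‖ₑ ^ 2 := fun k =>
    (measurable_shiftedError r B N k).enorm.pow_const 2
  rw [lintegral_tsum fun k => ((hmeas k).const_mul _).aemeasurable]
  simp only [fun k => lintegral_const_mul (μ := volume.restrict (unitCube d))
    (∏ j, decay r (k j : ℤ)) (hmeas k), lintegral_shiftedError r hB hN, ← ENNReal.tsum_mul_left]
  rw [ENNReal.tsum_comm]
  refine ENNReal.tsum_le_tsum fun l => ?_
  by_cases hl : l = 0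
  · simp [hl]
  simp only [hl, if_false]
  set y := B.transpose.mulVec (intVec l)
  calc ∑' k : Fin d → ℤ, (∏ j, decay r (k j)) * ‖bsplineFT r (intVec k + y)‖ₑ ^ 2
      = ∑' k : Fin d → ℤ, ∏ j, decay r (k j) * ‖hatFT 1 1 (k j + y j) ^ (r + 1)‖ₑ ^ 2 := by
        refine tsum_congr fun k => ?_
        rw [Finset.prod_mul_distrib, Finset.prod_pow, bsplineFT, ← ofReal_norm, norm_prod,
          ENNReal.ofReal_prod_of_nonneg fun _ _ => norm_nonneg _]
        simp only [ofReal_norm]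
        rfl
    _ = ∏ j, ∑' i : ℤ, decay r i * ‖hatFT 1 1 (i + y j) ^ (r + 1)‖ₑ ^ 2 :=
        tsum_pi_prod_eq_prod_tsum fun j (i : ℤ) =>
          decay r i * ‖hatFT 1 1 (i + y j) ^ (r + 1)‖ₑ ^ 2
    _ ≤ ∏ j, C * decay r (y j) := Finset.prod_le_prod' fun j _ => h (y j)
    _ = C ^ d * ∏ j, decay r (y j) := by
        rw [Finset.prod_mul_distrib]
        simp

/-- Cubature formulas with `O(t^d)` knots, `d = e + 1`, whose worst-case error has the optimal order:
the lattice formula for a shift at which the error does not exceed its average. -/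
lemma exists_cubature_of_dilation {r : ℕ} (hr : 1 ≤ r) (e : ℕ) :
    ∃ (C : ℝ≥0∞) (K : ℕ), C ≠ ∞ ∧ 1 ≤ K ∧ ∀ t : ℕ, 1 ≤ t →
      ∃ (N : Finset (Fin (e + 1) → ℤ)) (ξ : (Fin (e + 1) → ℤ) → Fin (e + 1) → ℝ)
        (w : (Fin (e + 1) → ℤ) → ℝ), N.card ≤ (K * t) ^ (e + 1) ∧
        (∀ n, ξ n ∈ unitCube (e + 1)) ∧
        ∑' k : Fin (e + 1) → ℤ, (∏ j, decay r (k j)) *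
          ‖(if k = 0 then 1 else 0) - ∑ n ∈ N, (w n : ℂ) * chr (intVec k) (ξ n)‖ₑ ^ 2 ≤
        C * ENNReal.ofReal ((((t : ℝ) ^ (e + 1)) ^ (2 * r))⁻¹) *
          ENNReal.ofReal (1 + Real.log ((t : ℝ) ^ (e + 1))) ^ e := by
  obtain ⟨W, hWdet, hW⟩ := exists_admissible_matrix (d := e + 1) (by omega)
  obtain ⟨C₁, hC₁, hav⟩ := exists_lintegral_tsum_shiftedError_le (e + 1) r
  obtain ⟨C₂, hC₂, hbox⟩ := exists_tsum_min_le e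
  set M : ℝ := (∑ i, ∑ j, |W j i|) * (((r : ℝ) + 1) / 2) + 1 with hM
  have hM1 : 1 ≤ M := by
    have : 0 ≤ ∑ i, ∑ j, |W j i| := Finset.sum_nonneg fun _ _ => Finset.sum_nonneg fun _ _ =>
      abs_nonneg _
    rw [hM, le_add_iff_nonneg_left]
    positivity
  set K := ⌈M⌉₊ with hK
  have hK1 : 1 ≤ K := Nat.one_le_ceil_iff.2 (by linarith)
  refine ⟨C₁ * (ENNReal.ofReal (8 * (2 * 4 ^ e) ^ (2 * r)) * ENNReal.ofReal C₂ ^ e), 3 * K,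
    by finiteness, by omega, fun t ht => ?_⟩
  have ht0 : (0 : ℝ) < t := by exact_mod_cast ht
  have ht1 : (1 : ℝ) ≤ t := by exact_mod_cast ht
  set B : Matrix (Fin (e + 1)) (Fin (e + 1)) ℝ := (t : ℝ) • W.transpose with hBdef
  have hBdet : B.det ≠ 0 := by
    rw [hBdef, Matrix.det_smul, Matrix.det_transpose]
    exact mul_ne_zero (pow_ne_zero _ ht0.ne') hWdet
  have hBt : ∀ v, B.transpose.mulVec v = (t : ℝ) • W.mulVec v := by
    intro v
    rw [hBdef, Matrix.transpose_smul, Matrix.transpose_transpose, Matrix.smul_mulVec]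
  have hR : ∀ i, (∑ j, |B i j|) * (((r : ℝ) + 1) / 2) + 1 ≤ ((K * t : ℕ) : ℝ) := by
    intro i
    have h1 : ∑ j, |B i j| = t * ∑ j, |W j i| := by
      rw [Finset.mul_sum]
      refine Finset.sum_congr rfl fun j _ => ?_
      rw [hBdef, Matrix.smul_apply, Matrix.transpose_apply, smul_eq_mul, abs_mul,
        abs_of_pos ht0]
    have h2 : ∑ j, |W j i| ≤ ∑ i, ∑ j, |W j i| :=
      Finset.single_le_sum (f := fun i => ∑ j, |W j i|)
        (fun _ _ => Finset.sum_nonneg fun _ _ => abs_nonneg _) (Finset.mem_univ i)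
    have h3 : M ≤ K := Nat.le_ceil _
    calc (∑ j, |B i j|) * (((r : ℝ) + 1) / 2) + 1
        ≤ t * ((∑ i, ∑ j, |W j i|) * (((r : ℝ) + 1) / 2)) + t * 1 := by
          rw [h1, mul_assoc]
          gcongr
          linarith
      _ = M * t := by rw [hM]; ring
      _ ≤ _ := by push_cast; gcongr
  have hN : ∀ s ∈ unitCube (e + 1), ∀ n ∉ intBox (e + 1) (K * t),
      bspline r (B⁻¹.mulVec (s + intVec n)) = 0 := fun s hs n hn =>
    bspline_inv_mulVec_eq_zero r hBdet hR hs hn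
  set X : ℝ := (t : ℝ) ^ (e + 1) with hX
  have hX1 : 1 ≤ X := one_le_pow₀ ht1
  have hsum := tsum_decay_admissible_le hr (fun n => B.transpose.mulVec (intVec n))
    (by simp) (zero_lt_one.trans_le hX1) (fun n n' hne => by
      have h1 : ∀ j, |B.transpose.mulVec (intVec n) j - B.transpose.mulVec (intVec n') j| =
          t * |W.mulVec (intVec (n - n')) j| := by
        intro j
        have : intVec (n - n') = intVec n - intVec n' := by ext; simp [intVec]
        rw [hBt, hBt, this, Matrix.mulVec_sub, Pi.smul_apply, Pi.smul_apply, Pi.sub_apply,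
          ← smul_sub, smul_eq_mul, abs_mul, abs_of_pos ht0]
      simp only [h1]
      rw [Finset.prod_mul_distrib, Finset.prod_const, Finset.card_univ, Fintype.card_fin]
      exact le_mul_of_one_le_right (by positivity) (hW _ (sub_ne_zero.2 hne)))
  have hfin := (hav B hBdet (intBox (e + 1) (K * t)) hN).trans
    (mul_le_mul' le_rfl (hsum.trans (mul_le_mul' le_rfl (hbox X hX1))))
  have hmeas : Measurable fun s => ∑' k : Fin (e + 1) → ℤ, (∏ j, decay r (k j)) *
      ‖shiftedError r B (intBox (e + 1) (K * t)) k s‖ₑ ^ 2 :=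
    Measurable.tsum fun k =>
      ((measurable_shiftedError r B _ k).enorm.pow_const 2).const_mul _
  obtain ⟨s, -, hs⟩ := exists_le_setLAverage (μ := volume) (s := unitCube (e + 1))
    (by simp) (by simp) hmeas.aemeasurable
  rw [setLAverage_eq, volume_unitCube, div_one] at hs
  refine ⟨intBox (e + 1) (K * t), fun n j => Int.fract (B⁻¹.mulVec (s + intVec n) j),
    fun n => |B⁻¹.det| * bspline r (B⁻¹.mulVec (s + intVec n)), ?_, fun n j _ =>
      ⟨Int.fract_nonneg _, Int.fract_lt_one _⟩, ?_⟩
  · rw [intBox, Fintype.card_piFinset]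
    simp only [Int.card_Icc, Finset.prod_const, Finset.card_univ, Fintype.card_fin]
    refine Nat.pow_le_pow_left ?_ _
    have : 1 ≤ K * t := Nat.mul_pos hK1 ht
    rw [mul_assoc]
    omega
  · have hfract : ∀ (k : Fin (e + 1) → ℤ) (x : Fin (e + 1) → ℝ),
        chr (intVec k) (fun j => Int.fract (x j)) = chr (intVec k) x := by
      intro k x
      rw [← chr_intVec_add_intVec _ k (fun j => ⌊x j⌋)]
      congr 1
      ext j
      exact Int.fract_add_floor (x j)
    simp only [hfract]
    refine (hs.trans hfin).trans (le_of_eq ?_)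
    have hlog : 0 ≤ 1 + Real.log X := by linarith [Real.log_nonneg hX1]
    rw [ENNReal.ofReal_mul hC₂.le, mul_pow]
    ring

end Average

section Assembly

variable {d m : ℕ}

/-- Knots of weight zero can be added to a cubature formula. -/
lemma exists_fin_knots (N : Finset (Fin d → ℤ)) (hN : N.card ≤ m)
    (ξ : (Fin d → ℤ) → Fin d → ℝ) (w : (Fin d → ℤ) → ℝ) (hξ : ∀ n, ξ n ∈ unitCube d) :
    ∃ (ξ' : Fin m → Fin d → ℝ) (w' : Fin m → ℝ), (∀ μ, ξ' μ ∈ unitCube d) ∧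
      ∀ f : (Fin d → ℝ) → ℂ, ∑ μ, (w' μ : ℂ) * f (ξ' μ) = ∑ n ∈ N, (w n : ℂ) * f (ξ n) := by
  obtain ⟨ι⟩ : Nonempty (N ↪ Fin m) := by
    rw [Function.Embedding.nonempty_iff_card_le]
    simpa using hN
  refine ⟨Function.extend ι (fun n => ξ n) 0, Function.extend ι (fun n => w n) 0, fun μ => ?_,
    fun f => ?_⟩
  · by_cases h : ∃ n, ι n = μ
    · obtain ⟨n, rfl⟩ := h
      rw [ι.injective.extend_apply]
      exact hξ n
    · rw [Function.extend_apply' _ _ _ h]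
      intro j _
      simp
  · rw [← Finset.sum_coe_sort N fun n => (w n : ℂ) * f (ξ n)]
    symm
    refine Fintype.sum_of_injective ι ι.injective _ _ (fun μ hμ => ?_) fun n => ?_
    · rw [Function.extend_apply' _ _ _ (by simpa using hμ)]
      simp
    · rw [ι.injective.extend_apply, ι.injective.extend_apply]

lemma sqWorstCaseError_zero (r : ℕ) (ξ : Fin m → Fin d → ℝ) :
    sqWorstCaseError r ξ 0 = 1 := by
  rw [sqWorstCaseError, tsum_eq_single 0]
  · simp [charError, decay]
  · intro k hk
    simp [charError, hk]

/-- The optimal order of the worst-case error in the Sobolev space of mixed smoothness `r`. -/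
theorem exists_sqWorstCaseError_le {r : ℕ} (hr : 1 ≤ r) (e : ℕ) :
    ∃ C : ℝ, 0 < C ∧ ∀ m : ℕ, 2 ≤ m → ∃ (ξ : Fin m → Fin (e + 1) → ℝ) (w : Fin m → ℝ),
      (∀ μ, ξ μ ∈ unitCube (e + 1)) ∧
        sqWorstCaseError r ξ w ≤ ENNReal.ofReal (C * ((m : ℝ) ^ (2 * r))⁻¹ * Real.log m ^ e) := by
  obtain ⟨C, K, hC, hK, h⟩ := exists_cubature_of_dilation hr e
  have hlog2 : 0 < Real.log 2 := Real.log_pos one_lt_two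
  set L : ℝ := (Real.log 2)⁻¹ + 1 with hL
  have hLpos : 0 < L := by positivity
  set A : ℝ := ((2 * K : ℝ) ^ (e + 1)) ^ (2 * r) * L ^ e with hA
  have hKpos : (0 : ℝ) < K := by exact_mod_cast hK
  have hApos : 0 < A := by positivity
  refine ⟨(C.toReal + 1) * A, by positivity, fun m hm => ?_⟩
  have hm2 : (2 : ℝ) ≤ m := by exact_mod_cast hm
  have hlogm : Real.log 2 ≤ Real.log m := Real.log_le_log two_pos hm2
  have hlogm0 : 0 < Real.log m := hlog2.trans_le hlogm
  have hLm : 1 + Real.log m ≤ L * Real.log m := by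
    rw [hL, add_mul, one_mul, add_le_add_iff_right, ← div_eq_inv_mul, one_le_div hlog2]
    exact hlogm
  -- For small `m` this is used with `X = 1`, otherwise with `X = t ^ (e + 1)`.
  have hkey : ∀ X : ℝ, 0 < X → (m : ℝ) ≤ (2 * K : ℝ) ^ (e + 1) * X →
      (X ^ (2 * r))⁻¹ * (1 + Real.log m) ^ e ≤ A * ((m : ℝ) ^ (2 * r))⁻¹ * Real.log m ^ e := by
    intro X hX hmX
    have h1 : (X ^ (2 * r))⁻¹ ≤ ((2 * K : ℝ) ^ (e + 1)) ^ (2 * r) * ((m : ℝ) ^ (2 * r))⁻¹ := by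
      rw [← div_eq_mul_inv, le_div_iff₀ (by positivity), inv_mul_le_iff₀ (by positivity),
        mul_comm (X ^ (2 * r)), ← mul_pow]
      gcongr
    calc (X ^ (2 * r))⁻¹ * (1 + Real.log m) ^ e
        ≤ (((2 * K : ℝ) ^ (e + 1)) ^ (2 * r) * ((m : ℝ) ^ (2 * r))⁻¹) * (L * Real.log m) ^ e := by
          gcongr
      _ = _ := by rw [hA, mul_pow L]; ring
  -- The largest dilation for which the formula has at most `m` knots; it is `0` for small `m`,
  -- where all weights are taken to be zero.
  set t := Nat.findGreatest (fun t => (K * t) ^ (e + 1) ≤ m) m with ht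
  have hspec : (K * t) ^ (e + 1) ≤ m :=
    Nat.findGreatest_spec (P := fun t => (K * t) ^ (e + 1) ≤ m) (Nat.zero_le m) (by simp)
  have hlt : m < (K * (t + 1)) ^ (e + 1) := by
    by_contra hcon
    push Not at hcon
    have h1 : t + 1 ≤ (K * (t + 1)) ^ (e + 1) :=
      (Nat.le_mul_of_pos_left _ hK).trans (Nat.le_self_pow (by omega) _)
    have := Nat.le_findGreatest (P := fun t => (K * t) ^ (e + 1) ≤ m) (h1.trans hcon) hcon
    omega
  rcases Nat.eq_zero_or_pos t with ht0 | htpos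
  · refine ⟨0, 0, fun μ j _ => by simp, ?_⟩
    rw [sqWorstCaseError_zero, ← ENNReal.ofReal_one]
    refine ENNReal.ofReal_le_ofReal ?_
    rw [ht0, zero_add, mul_one] at hlt
    have h1 : (m : ℝ) ≤ (2 * K : ℝ) ^ (e + 1) * 1 := by
      have h2 : (m : ℝ) ≤ (K : ℝ) ^ (e + 1) := by exact_mod_cast hlt.le
      rw [mul_one]
      refine h2.trans ?_
      gcongr
      linarith
    have h2 := hkey 1 one_pos h1
    have h3 : (1 : ℝ) ≤ (1 + Real.log m) ^ e := one_le_pow₀ (by linarith)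
    have h4 : 0 ≤ C.toReal * (A * ((m : ℝ) ^ (2 * r))⁻¹ * Real.log m ^ e) := by positivity
    simp only [one_pow, inv_one, one_mul] at h2
    linarith
  · obtain ⟨N, ξ, w, hcard, hξ, hle⟩ := h t htpos
    obtain ⟨ξ', w', hξ', hsum⟩ := exists_fin_knots N (hcard.trans hspec) ξ w hξ
    refine ⟨ξ', w', hξ', ?_⟩
    rw [sqWorstCaseError]
    simp only [charError, fun k => hsum (chr (intVec k))]
    refine hle.trans ?_
    have ht1 : (1 : ℝ) ≤ t := by exact_mod_cast htpos
    set X : ℝ := (t : ℝ) ^ (e + 1) with hX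
    have hX1 : 1 ≤ X := one_le_pow₀ ht1
    have hXm : X ≤ m := by
      have h1 : t ^ (e + 1) ≤ m :=
        (Nat.pow_le_pow_left (Nat.le_mul_of_pos_left _ hK) _).trans hspec
      rw [hX]
      exact_mod_cast h1
    have hmX : (m : ℝ) ≤ (2 * K : ℝ) ^ (e + 1) * X := by
      have h1 : (m : ℝ) ≤ ((K : ℝ) * (t + 1)) ^ (e + 1) := by exact_mod_cast hlt.le
      refine h1.trans ?_
      rw [hX, ← mul_pow]
      exact pow_le_pow_left₀ (by positivity) (by nlinarith) _
    have h0 : 0 ≤ 1 + Real.log X := by linarith [Real.log_nonneg hX1]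
    rw [← ENNReal.ofReal_pow h0, ← ENNReal.ofReal_toReal hC,
      ← ENNReal.ofReal_mul ENNReal.toReal_nonneg, ← ENNReal.ofReal_mul (by positivity),
      ENNReal.toReal_ofReal ENNReal.toReal_nonneg]
    refine ENNReal.ofReal_le_ofReal ?_
    have h2 : (X ^ (2 * r))⁻¹ * (1 + Real.log X) ^ e ≤
        A * ((m : ℝ) ^ (2 * r))⁻¹ * Real.log m ^ e := by
      refine le_trans ?_ (hkey X (by linarith) hmX)
      gcongr
    calc C.toReal * (X ^ (2 * r))⁻¹ * (1 + Real.log X) ^ e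
        = C.toReal * ((X ^ (2 * r))⁻¹ * (1 + Real.log X) ^ e) := by ring
      _ ≤ (C.toReal + 1) * (A * ((m : ℝ) ^ (2 * r))⁻¹ * Real.log m ^ e) := by
          gcongr
          linarith
      _ = _ := by ring

end Assembly

end SmoothDiscrepancy

theorem proposition3p1 (r d : ℕ) (hr : 1 ≤ r) (hd : 1 ≤ d) :
    ∃ C : ℝ, 0 < C ∧ ∀ m : ℕ, 2 ≤ m →
      ∃ (ξ : Fin m → Fin d → ℝ) (w : Fin m → ℝ),
        (∀ μ, ξ μ ∈ SmoothDiscrepancy.unitCube d) ∧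
          SmoothDiscrepancy.periodicDiscrepancy r 2 ∞ ξ w ≤
            ENNReal.ofReal
              (C * (m : ℝ) ^ (-(r : ℝ)) * Real.log (m : ℝ) ^ (((d : ℝ) - 1) / 2)) := by
  obtain ⟨e, rfl⟩ : ∃ e, d = e + 1 := ⟨d - 1, by omega⟩
  obtain ⟨C, hC, h⟩ := SmoothDiscrepancy.exists_sqWorstCaseError_le hr e
  refine ⟨√C, Real.sqrt_pos.2 hC, fun m hm => ?_⟩
  obtain ⟨ξ, w, hξ, hle⟩ := h m hm
  refine ⟨ξ, w, hξ, (SmoothDiscrepancy.periodicDiscrepancy_le hr ξ hξ w).trans ?_⟩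
  have hm2 : (2 : ℝ) ≤ m := by exact_mod_cast hm
  have hlog : 0 ≤ Real.log m := Real.log_nonneg (by linarith)
  refine (ENNReal.rpow_le_rpow hle (by norm_num)).trans (le_of_eq ?_)
  rw [ENNReal.ofReal_rpow_of_nonneg (by positivity) (by norm_num), ← Real.sqrt_eq_rpow]
  congr 1
  rw [Real.sqrt_eq_iff_mul_self_eq (by positivity) (by positivity)]
  have h1 : (m : ℝ) ^ (-(r : ℝ)) * (m : ℝ) ^ (-(r : ℝ)) = ((m : ℝ) ^ (2 * r))⁻¹ := by
    rw [Real.rpow_neg (by linarith), Real.rpow_natCast, ← mul_inv, ← pow_add, two_mul]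
  have h2 : Real.log m ^ ((((e + 1 : ℕ) : ℝ) - 1) / 2) *
      Real.log m ^ ((((e + 1 : ℕ) : ℝ) - 1) / 2) = Real.log m ^ e := by
    have hlogpos : 0 < Real.log m := Real.log_pos (by linarith)
    rw [← Real.rpow_add hlogpos, add_halves]
    push_cast
    rw [add_sub_cancel_right, Real.rpow_natCast]
  rw [mul_mul_mul_comm, mul_mul_mul_comm √C, h1, h2, Real.mul_self_sqrt hC.le]
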